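/- Let $\alpha=\beta/(4\pi)>0$. By a solution of the stationary equation $$\alpha(\psi''-2\psi\psi')+2\psi=0$$ we mean an odd $C^2$ function $\psi:\mathbb R\to\mathbb R$ satisfying the equation on $\mathbb R$ and the periodic conditions $\psi(-\pi)=\psi(\pi)$, $\psi'(-\pi)=\psi'(\pi)$. (i) If $\alpha\ge 2$ (i.e. $\beta\ge 8\pi$), then $\psi\equiv 0$ is the unique solution. (ii) If $2/(k+1)^2\le\alpha<2/k^2$ for some integer $k\ge 1$, then there are exactly $2k$ nontrivial solutions $\psi_j^{+},\psi_j^{-}$, $j=1,\dots,k$. Both $\psi_j^{+}$ and $\psi_j^{-}$ have fundamental (least positive) period $2\pi/j$, $(\psi_j^{+})'(0)>0>(\psi_j^{-})'(0)$, and $\psi_j^{-}(x)=\psi_j^{+}(x+\pi/j)$ for all $x\in\mathbb{R}$. (iii) For every $j\ge1$ the solutions $\psi_j^{\pm}=\psi_j^{\pm}(\alpha)$, $0<\alpha<\alpha_j$, form branches that bifurcate from the trivial solution at $\alpha_j=2/j^2$ (i.e. $\beta_j=8\pi/j^2$): they depend continuously on $\alpha$, and $\lim_{\alpha\uparrow\alpha_j}\psi_j^{\pm}=0$,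 where continuity and limit are understood in the $C^1$ sense (uniformly on $\mathbb R$ for $\psi_j^\pm$ and for its derivative). (iv) In the phase plane the orbits $\{((\psi_j^{\pm})'(x),\psi_j^{\pm}(x)):x\in\mathbb R\}$ of these periodic solutions go around the origin: the origin is not on the orbit and lies in a bounded connected component of its complement. For every $j\ge 1$, the Euclidean distance of each of the two orbits from the origin, and also the coordinate $(\psi_j^{+})'(0)$ at which the orbit meets the positive $\psi'$-axis, are strictly decreasing functions of $\alpha\in(0,\alpha_j)$. -/

import Mathlib

open scoped Topology Real

/-- `ψ` is an odd classical solution of `α (ψ'' - 2 ψ ψ') + 2 ψ = 0` with the periodic conditions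
`ψ (-π) = ψ π` and `ψ' (-π) = ψ' π`. -/
structure IsStationarySolution (α : ℝ) (ψ : ℝ → ℝ) : Prop where
  contDiff : ContDiff ℝ 2 ψ
  equation : ∀ x : ℝ, α * (deriv (deriv ψ) x - 2 * ψ x * deriv ψ x) + 2 * ψ x = 0
  odd : ∀ x : ℝ, ψ (-x) = -ψ x
  periodic_value : ψ (-π) = ψ π
  periodic_deriv : deriv ψ (-π) = deriv ψ π

/-- `T` is the fundamental (least positive) period of `ψ`. -/
def HasFundamentalPeriod (ψ : ℝ → ℝ) (T : ℝ) : Prop :=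
  IsLeast {t : ℝ | 0 < t ∧ Function.Periodic ψ t} T

/-- The orbit `{(ψ' x, ψ x) : x ∈ ℝ}` in the phase plane (with its Euclidean metric). -/
noncomputable def phaseOrbit (ψ : ℝ → ℝ) : Set (EuclideanSpace ℝ (Fin 2)) :=
  Set.range fun x : ℝ => !₂[deriv ψ x, ψ x]

/-- The planar set `C` goes around the origin: the origin is not on `C` and lies in a bounded
connected component of the complement of `C`. -/
def EnclosesOrigin (C : Set (EuclideanSpace ℝ (Fin 2))) : Prop :=
  0 ∉ C ∧ Bornology.IsBounded (connectedComponentIn Cᶜ 0)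

/-- The functions `φ α` converge to `f` in the `C¹` sense, uniformly on `ℝ`, along the filter `l`
of parameters. -/
def TendstoC1 (φ : ℝ → ℝ → ℝ) (f : ℝ → ℝ) (l : Filter ℝ) : Prop :=
  TendstoUniformly φ f l ∧ TendstoUniformly (fun α => deriv (φ α)) (deriv f) l

/-- `φ` is a branch of nontrivial odd periodic solutions, defined for the parameters
`0 < α < a` and continuous in `α`, which bifurcates from the trivial solution at `α = a`. -/
structure BifurcatesFromZero (a : ℝ) (φ : ℝ → ℝ → ℝ) : Prop where
  solution : ∀ α ∈ Set.Ioo 0 a, IsStationarySolution α (φ α)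
  nontrivial : ∀ α ∈ Set.Ioo 0 a, φ α ≠ 0
  continuous : ∀ α ∈ Set.Ioo 0 a, TendstoC1 φ (φ α) (𝓝 α)
  tendsto_zero : TendstoC1 φ 0 (𝓝[<] a)

/-- The parameter `α = β / (4π)` of the stationary equation at inverse temperature `β`. -/
noncomputable def couplingOfBeta (β : ℝ) : ℝ := β / (4 * π)

/-! Put `w = log (1 - α ψ')`. The equation becomes `w' = 2 ψ`, hence `w'' = (2/α)(1 - e^w)`: an
oscillator with conserved energy `V(w) + α ψ² = r²`, where `V(w) = e^w - 1 - w`. In terms of `s =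
potRoot w`, the signed square root of `V(w)`, energy levels are circles: `s = -r cos θ`, `√α ψ = r
sin θ`. With `g = potInv` the inverse of `potRoot` and the time `y = 2x/√α`, the motion is `dy =
g'(-r cos θ) dθ`. Periodicity forces `ψ'(0) < 1/α`, so by uniqueness for the initial value problem
every solution is some `wave α r`.

The crux is that the half period `T(r) = ∫_0^π g'(-r cos φ) dφ` strictly increases for `r ≥ 0`.
Since `cos` integrates to zero over `[0, π]`, `2s/3` may be added to `g'(s)`, and the sum strictly
increases along both rays from `0` (`potInvDeriv_add_lt`); this comes down to `exp_cubic_pos`.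
Moreover `T(0) = √2 π` and `T(r) ≥ rπ/3`.

A solution vanishes at `π`, so if nontrivial it satisfies `2π/√α = j T(r)` for some `j ≥ 1`. Up to
sign there is exactly one such `r ≠ 0` when `α < 2/j²`, and none otherwise. This `r` is continuous
and strictly decreasing in `α` and tends to `0` at `2/j²`, which gives the branches. The orbits are
energy levels; each is nearest to the origin at one of two axis points, at distances `r/√α` and
`(ψ⁺)'(0)`, both strictly decreasing in `α`. -/

/-! ### The potential, its signed square root and the inverse of that root. -/

/-- The potential `e^w - 1 - w` of the oscillator `w'' = 2 c (1 - e^w)`. -/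
noncomputable def expPot (w : ℝ) : ℝ := Real.exp w - 1 - w

/-- The quotient `(e^w - 1 - w) / w²`, continuously extended to `w = 0`. -/
noncomputable def expPotQuot (w : ℝ) : ℝ := if w = 0 then 1 / 2 else expPot w / w ^ 2

/-- The signed square root of the potential. -/
noncomputable def potRoot (w : ℝ) : ℝ := w * √(expPotQuot w)

/-- The derivative of `potRoot`. -/
noncomputable def potRootDeriv (w : ℝ) : ℝ := dslope Real.exp 0 w / (2 * √(expPotQuot w))

lemma expPot_pos {w : ℝ} (hw : w ≠ 0) : 0 < expPot w := by
  have := Real.add_one_lt_exp hw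
  unfold expPot; linarith

lemma expPotQuot_pos (w : ℝ) : 0 < expPotQuot w := by
  unfold expPotQuot
  split_ifs with h
  · norm_num
  · have := expPot_pos h
    positivity

lemma hasDerivAt_expPot (w : ℝ) : HasDerivAt expPot (Real.exp w - 1) w :=
  ((Real.hasDerivAt_exp w).sub_const 1).sub (hasDerivAt_id w)

lemma continuous_expPot : Continuous expPot :=
  continuous_iff_continuousAt.2 fun w => (hasDerivAt_expPot w).continuousAt

lemma abs_expPotQuot_sub_le {w : ℝ} (hw : |w| ≤ 1) : |expPotQuot w - 1 / 2| ≤ |w| := by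
  unfold expPotQuot
  split_ifs with h
  · simp
  · have hb := Real.exp_bound hw (n := 3) (by norm_num)
    simp only [Finset.sum_range_succ, Finset.sum_range_zero] at hb
    norm_num [Nat.factorial] at hb
    have e : expPot w / w ^ 2 - 1 / 2 = (Real.exp w - (1 + w + w ^ 2 / 2)) / w ^ 2 := by
      unfold expPot; field_simp; ring
    rw [e, abs_div, abs_of_nonneg (sq_nonneg w), div_le_iff₀ (by positivity)]
    have h3 : |w| * w ^ 2 = |w| ^ 3 := by rw [← sq_abs]; ring
    rw [h3]
    have : 0 ≤ |w| ^ 3 := by positivity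
    linarith

lemma continuous_expPotQuot : Continuous expPotQuot := by
  rw [continuous_iff_continuousAt]
  intro w
  rcases eq_or_ne w 0 with rfl | h
  · have h0 : expPotQuot 0 = 1 / 2 := by simp [expPotQuot]
    rw [ContinuousAt, h0, tendsto_iff_dist_tendsto_zero]
    refine squeeze_zero' (Filter.Eventually.of_forall fun _ => dist_nonneg)
      (g := fun w : ℝ => |w|) ?_ ?_
    · have : Metric.closedBall (0 : ℝ) 1 ∈ 𝓝 (0 : ℝ) := Metric.closedBall_mem_nhds _ one_pos
      filter_upwards [this] with w hw
      rw [Real.dist_eq]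
      exact abs_expPotQuot_sub_le (by simpa using hw)
    · simpa using (continuous_abs (G := ℝ)).tendsto 0
  · have : (fun w => expPot w / w ^ 2) =ᶠ[𝓝 w] expPotQuot := by
      filter_upwards [isOpen_ne.mem_nhds h] with y hy
      simp [expPotQuot, show y ≠ 0 from hy]
    refine ContinuousAt.congr ?_ this
    exact (continuous_expPot.continuousAt).div (by fun_prop) (by positivity)

lemma continuous_potRoot : Continuous potRoot :=
  continuous_id.mul continuous_expPotQuot.sqrt

lemma potRoot_sq (w : ℝ) : potRoot w ^ 2 = expPot w := by
  rw [potRoot, mul_pow, Real.sq_sqrt (expPotQuot_pos w).le, expPotQuot]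
  split_ifs with h
  · simp [h, expPot]
  · field_simp

@[simp] lemma potRoot_zero : potRoot 0 = 0 := by simp [potRoot]

lemma potRoot_pos {w : ℝ} (hw : 0 < w) : 0 < potRoot w :=
  mul_pos hw (Real.sqrt_pos.2 (expPotQuot_pos w))

lemma potRoot_neg {w : ℝ} (hw : w < 0) : potRoot w < 0 :=
  mul_neg_of_neg_of_pos hw (Real.sqrt_pos.2 (expPotQuot_pos w))

lemma potRoot_ne_zero {w : ℝ} (hw : w ≠ 0) : potRoot w ≠ 0 :=
  mul_ne_zero hw (Real.sqrt_pos.2 (expPotQuot_pos w)).ne'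

lemma mul_dslope_exp (w : ℝ) : w * dslope Real.exp 0 w = Real.exp w - 1 := by
  have := sub_smul_dslope Real.exp 0 w
  simpa using this

lemma dslope_exp_pos (w : ℝ) : 0 < dslope Real.exp 0 w := by
  rcases eq_or_ne w 0 with rfl | h
  · simp [dslope_same]
  · have e := mul_dslope_exp w
    rcases lt_or_gt_of_ne h with h | h
    · have := Real.exp_lt_one_iff.2 h
      by_contra! hc
      nlinarith [mul_nonneg_of_nonpos_of_nonpos h.le hc]
    · have := Real.one_lt_exp_iff.2 h
      by_contra! hc
      nlinarith [mul_nonpos_of_nonneg_of_nonpos h.le hc]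

lemma continuous_dslope_exp : Continuous (dslope Real.exp 0) := by
  rw [← continuousOn_univ, continuousOn_dslope Filter.univ_mem]
  exact ⟨Real.continuous_exp.continuousOn, Real.differentiable_exp 0⟩

lemma potRootDeriv_pos (w : ℝ) : 0 < potRootDeriv w := by
  have := Real.sqrt_pos.2 (expPotQuot_pos w)
  have := dslope_exp_pos w
  unfold potRootDeriv; positivity

lemma continuous_potRootDeriv : Continuous potRootDeriv :=
  continuous_dslope_exp.div (continuous_const.mul continuous_expPotQuot.sqrt) fun w =>
    (mul_pos two_pos (Real.sqrt_pos.2 (expPotQuot_pos w))).ne'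

lemma two_mul_potRoot_mul_deriv (w : ℝ) :
    2 * potRoot w * potRootDeriv w = Real.exp w - 1 := by
  have := (Real.sqrt_pos.2 (expPotQuot_pos w)).ne'
  rw [← mul_dslope_exp, potRoot, potRootDeriv]
  field_simp

lemma potRootDeriv_zero : potRootDeriv 0 = (√2)⁻¹ := by
  have h : √(1 / 2 : ℝ) = (√2)⁻¹ := by rw [one_div, Real.sqrt_inv]
  have h2 := Real.mul_self_sqrt (show (0 : ℝ) ≤ 2 by norm_num)
  have h3 : √(2 : ℝ) ≠ 0 := by positivity
  simp only [potRootDeriv, dslope_same, Real.deriv_exp, Real.exp_zero, expPotQuot, if_true]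
  rw [h]
  field_simp
  linarith

/-- At `0` the difference quotient is `√(expPotQuot w)`, which is continuous; elsewhere `potRoot` is
locally `√V` or `-√V`. -/
lemma hasDerivAt_potRoot (w : ℝ) : HasDerivAt potRoot (potRootDeriv w) w := by
  rcases eq_or_ne w 0 with rfl | h
  · rw [hasDerivAt_iff_tendsto_slope]
    have h1 : Filter.Tendsto (fun w => √(expPotQuot w)) (𝓝[≠] 0) (𝓝 (potRootDeriv 0)) := by
      have := (continuous_expPotQuot.sqrt.tendsto 0).mono_left
        (nhdsWithin_le_nhds (s := ({0}ᶜ : Set ℝ)))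
      convert this using 2
      rw [potRootDeriv_zero]
      simp [expPotQuot]
    refine h1.congr' ?_
    filter_upwards [self_mem_nhdsWithin] with w hw
    have hw : w ≠ 0 := hw
    rw [slope_def_field, potRoot_zero, sub_zero, sub_zero, potRoot]
    field_simp
  · have hV := (expPot_pos h).ne'
    have hs := (hasDerivAt_expPot w).sqrt hV
    have hne := potRoot_ne_zero h
    have key := two_mul_potRoot_mul_deriv w
    rcases lt_or_gt_of_ne h with h | h
    · have e : ∀ y < 0, potRoot y = -√(expPot y) := fun y hy => by
        rw [← potRoot_sq, Real.sqrt_sq_eq_abs, abs_of_neg (potRoot_neg hy), neg_neg]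
      have ev : potRoot =ᶠ[𝓝 w] fun y => -√(expPot y) := by
        filter_upwards [isOpen_Iio.mem_nhds h] with y hy using e y hy
      have e2 : √(expPot w) = - potRoot w := by rw [e w h, neg_neg]
      refine (hs.neg.congr_of_eventuallyEq ev).congr_deriv ?_
      rw [e2, ← key]
      field_simp
    · have e : ∀ y, 0 < y → potRoot y = √(expPot y) := fun y hy => by
        rw [← potRoot_sq, Real.sqrt_sq_eq_abs, abs_of_pos (potRoot_pos hy)]
      have ev : potRoot =ᶠ[𝓝 w] fun y => √(expPot y) := by
        filter_upwards [isOpen_Ioi.mem_nhds h] with y hy using e y hy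
      refine (hs.congr_of_eventuallyEq ev).congr_deriv ?_
      rw [← e w h, ← key]
      field_simp

lemma strictMono_potRoot : StrictMono potRoot :=
  strictMono_of_deriv_pos fun w => by
    rw [(hasDerivAt_potRoot w).deriv]; exact potRootDeriv_pos w

lemma surjective_potRoot : Function.Surjective potRoot := by
  have hexp : ∀ w : ℝ, 0 ≤ w → w ^ 2 / 2 ≤ expPot w := fun w hw => by
    have := Real.quadratic_le_exp_of_nonneg hw
    unfold expPot; linarith
  intro s
  have hlo : ∃ a, potRoot a ≤ s := by
    -- `V(w) ≥ -1 - w`, and the right side is `s²` at this point.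
    refine ⟨-(s ^ 2 + 1), ?_⟩
    have hn : -(s ^ 2 + 1) < 0 := by nlinarith [sq_nonneg s]
    have h1 := potRoot_neg hn
    have h2 := potRoot_sq (-(s ^ 2 + 1))
    have h3 : s ^ 2 ≤ expPot (-(s ^ 2 + 1)) := by
      have := Real.exp_pos (-(s ^ 2 + 1))
      unfold expPot; linarith
    by_contra! hc
    nlinarith
  have hhi : ∃ b, s ≤ potRoot b := by
    refine ⟨2 * |s| + 1, ?_⟩
    have h1 := potRoot_pos (show 0 < 2 * |s| + 1 by positivity)
    have h2 := potRoot_sq (2 * |s| + 1)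
    have h3 := hexp (2 * |s| + 1) (by positivity)
    by_contra! hc
    have h4 : |s| = s := abs_of_pos (h1.trans hc)
    rw [h4] at h1 h2 h3 hc
    nlinarith
  obtain ⟨a, ha⟩ := hlo
  obtain ⟨b, hb⟩ := hhi
  exact mem_range_of_exists_le_of_exists_ge continuous_potRoot ⟨a, ha⟩ ⟨b, hb⟩

/-- The signed square root of the potential as an order isomorphism. -/
noncomputable def potRootIso : ℝ ≃o ℝ :=
  strictMono_potRoot.orderIsoOfSurjective potRoot surjective_potRoot

/-- The inverse of `potRoot`. -/
noncomputable def potInv (s : ℝ) : ℝ := potRootIso.symm s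

/-- The derivative of `potInv`. -/
noncomputable def potInvDeriv (s : ℝ) : ℝ := (potRootDeriv (potInv s))⁻¹

lemma potRoot_potInv (s : ℝ) : potRoot (potInv s) = s := potRootIso.apply_symm_apply s

lemma potInv_potRoot (w : ℝ) : potInv (potRoot w) = w := potRootIso.symm_apply_apply w

lemma strictMono_potInv : StrictMono potInv := potRootIso.symm.strictMono

lemma continuous_potInv : Continuous potInv := potRootIso.symm.continuous

@[simp] lemma potInv_zero : potInv 0 = 0 := by simpa using potInv_potRoot 0

lemma expPot_potInv (s : ℝ) : expPot (potInv s) = s ^ 2 := by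
  rw [← potRoot_sq, potRoot_potInv]

lemma hasDerivAt_potInv (s : ℝ) : HasDerivAt potInv (potInvDeriv s) s :=
  (hasDerivAt_potRoot (potInv s)).of_local_left_inverse continuous_potInv.continuousAt
    (potRootDeriv_pos _).ne' (Filter.Eventually.of_forall potRoot_potInv)

lemma potInvDeriv_pos (s : ℝ) : 0 < potInvDeriv s := inv_pos.2 (potRootDeriv_pos _)

lemma continuous_potInvDeriv : Continuous potInvDeriv :=
  (continuous_potRootDeriv.comp continuous_potInv).inv₀ fun _ => (potRootDeriv_pos _).ne'

lemma potInvDeriv_zero : potInvDeriv 0 = √2 := by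
  rw [potInvDeriv, potInv_zero, potRootDeriv_zero, inv_inv]

/-- Derivative of `V(potInv s) = s²`. It later yields `ψ' = (1 - e^w)/α` for the waves. -/
lemma potInvDeriv_mul_exp_sub_one (s : ℝ) :
    potInvDeriv s * (Real.exp (potInv s) - 1) = 2 * s := by
  have := (potRootDeriv_pos (potInv s)).ne'
  rw [← two_mul_potRoot_mul_deriv, potRoot_potInv, potInvDeriv]
  field_simp

/-! ### The inequality behind the monotonicity of the period. -/

/-- The expression `Q` has `Q' = 3 e^w q` with `q' = 2 (e^w - 1)²` and `Q(0) = q(0) = 0`. So `q` has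
the sign of `w`, and `Q` has a strict minimum at `0`. -/
lemma exp_cubic_pos {w : ℝ} (hw : w ≠ 0) :
    0 < 3 * (Real.exp w - 1) ^ 2 - 6 * expPot w * Real.exp w + (Real.exp w - 1) ^ 3 := by
  set Q : ℝ → ℝ := fun w =>
    3 * (Real.exp w - 1) ^ 2 - 6 * expPot w * Real.exp w + (Real.exp w - 1) ^ 3 with hQ
  set q : ℝ → ℝ := fun w => Real.exp w ^ 2 - 4 * Real.exp w + 3 + 2 * w with hq
  have hq' : ∀ w, HasDerivAt q (2 * (Real.exp w - 1) ^ 2) w := fun w => by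
    have he := Real.hasDerivAt_exp w
    refine ((((he.pow 2).sub (he.const_mul 4)).add_const 3).add
      ((hasDerivAt_id w).const_mul 2)).congr_deriv ?_
    push_cast; ring
  have hQ' : ∀ w, HasDerivAt Q (3 * Real.exp w * q w) w := fun w => by
    have he := Real.hasDerivAt_exp w
    refine (((((he.sub_const 1).pow 2).const_mul 3).sub
      (((hasDerivAt_expPot w).const_mul 6).mul he)).add ((he.sub_const 1).pow 3)).congr_deriv ?_
    simp only [hq, expPot]; push_cast; ring
  have hqm : StrictMono q := by
    have hc : Continuous q := continuous_iff_continuousAt.2 fun w => (hq' w).continuousAt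
    have h1 : StrictMonoOn q (Set.Iic 0) := strictMonoOn_of_deriv_pos (convex_Iic 0) hc.continuousOn
      fun x hx => by
        rw [interior_Iic] at hx
        rw [(hq' x).deriv]
        have := Real.exp_lt_one_iff.2 hx
        have : Real.exp x - 1 ≠ 0 := by linarith
        positivity
    have h2 : StrictMonoOn q (Set.Ici 0) := strictMonoOn_of_deriv_pos (convex_Ici 0) hc.continuousOn
      fun x hx => by
        rw [interior_Ici] at hx
        rw [(hq' x).deriv]
        have := Real.one_lt_exp_iff.2 hx
        have : Real.exp x - 1 ≠ 0 := by linarith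
        positivity
    exact h1.Iic_union_Ici h2
  have hq0 : q 0 = 0 := by simp [hq]; norm_num
  have hQ0 : Q 0 = 0 := by simp [hQ, expPot]
  have hc : Continuous Q := continuous_iff_continuousAt.2 fun w => (hQ' w).continuousAt
  change 0 < Q w
  rcases lt_or_gt_of_ne hw with h | h
  · have h1 : StrictAntiOn Q (Set.Iic 0) := strictAntiOn_of_deriv_neg (convex_Iic 0) hc.continuousOn
      fun x hx => by
        rw [interior_Iic] at hx
        rw [(hQ' x).deriv]
        have h2 := hqm hx
        rw [hq0] at h2
        exact mul_neg_of_pos_of_neg (by positivity) h2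
    have := h1 (Set.mem_Iic.2 h.le) (Set.mem_Iic.2 le_rfl) h
    rwa [hQ0] at this
  · have h1 : StrictMonoOn Q (Set.Ici 0) := strictMonoOn_of_deriv_pos (convex_Ici 0) hc.continuousOn
      fun x hx => by
        rw [interior_Ici] at hx
        rw [(hQ' x).deriv]
        have h2 := hqm hx
        rw [hq0] at h2
        positivity
    have := h1 (Set.mem_Ici.2 le_rfl) (Set.mem_Ici.2 h.le) h
    rwa [hQ0] at this

/-- `potInvDeriv s + 2 s / 3` in the variable `w = potInv s`. -/
noncomputable def tiltedDeriv (w : ℝ) : ℝ := (potRootDeriv w)⁻¹ + 2 / 3 * potRoot w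

lemma continuous_tiltedDeriv : Continuous tiltedDeriv :=
  (continuous_potRootDeriv.inv₀ fun _ => (potRootDeriv_pos _).ne').add
    (continuous_const.mul continuous_potRoot)

lemma exp_sub_one_ne_zero {w : ℝ} (hw : w ≠ 0) : Real.exp w - 1 ≠ 0 := by
  rw [sub_ne_zero, Ne, Real.exp_eq_one_iff]; exact hw

lemma hasDerivAt_tiltedDeriv {w : ℝ} (hw : w ≠ 0) :
    HasDerivAt tiltedDeriv
      ((3 * (Real.exp w - 1) ^ 2 - 6 * expPot w * Real.exp w + (Real.exp w - 1) ^ 3) /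
        (3 * potRoot w * (Real.exp w - 1) ^ 2)) w := by
  have ev : tiltedDeriv =ᶠ[𝓝 w]
      fun y => 2 * potRoot y / (Real.exp y - 1) + 2 / 3 * potRoot y := by
    filter_upwards [isOpen_ne.mem_nhds hw] with y hy
    have hy : y ≠ 0 := hy
    have h1 := potRoot_ne_zero hy
    have h2 := (potRootDeriv_pos y).ne'
    rw [tiltedDeriv, ← two_mul_potRoot_mul_deriv]
    field_simp
  have hne := exp_sub_one_ne_zero hw
  have h1 := potRoot_ne_zero hw
  have hr := hasDerivAt_potRoot w
  have hd : potRootDeriv w = (Real.exp w - 1) / (2 * potRoot w) := by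
    rw [← two_mul_potRoot_mul_deriv]; field_simp
  refine ((((hr.const_mul 2).div ((Real.hasDerivAt_exp w).sub_const 1) hne).add
    (hr.const_mul (2 / 3))).congr_of_eventuallyEq ev).congr_deriv ?_
  rw [← potRoot_sq, hd]
  field_simp
  ring

/-- The constant `2/3` is forced: `potInvDeriv s = √2 - 2s/3 + O(s²)`, so only this tilt makes `0` a
critical point, hence possibly a minimum from both sides. -/
lemma strictMonoOn_tiltedDeriv : StrictMonoOn tiltedDeriv (Set.Ici 0) :=
  strictMonoOn_of_deriv_pos (convex_Ici 0) continuous_tiltedDeriv.continuousOn fun x hx => by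
    rw [interior_Ici] at hx
    have hx : 0 < x := hx
    rw [(hasDerivAt_tiltedDeriv hx.ne').deriv]
    have h1 := exp_sub_one_ne_zero hx.ne'
    have h2 := potRoot_pos hx
    exact div_pos (exp_cubic_pos hx.ne') (by positivity)

lemma strictAntiOn_tiltedDeriv : StrictAntiOn tiltedDeriv (Set.Iic 0) :=
  strictAntiOn_of_deriv_neg (convex_Iic 0) continuous_tiltedDeriv.continuousOn fun x hx => by
    rw [interior_Iic] at hx
    have hx : x < 0 := hx
    rw [(hasDerivAt_tiltedDeriv hx.ne).deriv]
    have h1 := exp_sub_one_ne_zero hx.ne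
    have h2 := potRoot_neg hx
    exact div_neg_of_pos_of_neg (exp_cubic_pos hx.ne)
      (mul_neg_of_neg_of_pos (by linarith) (by positivity))

lemma tiltedDeriv_potInv (s : ℝ) : tiltedDeriv (potInv s) = potInvDeriv s + 2 / 3 * s := by
  rw [tiltedDeriv, potRoot_potInv, potInvDeriv]

/-- The function `potInvDeriv s + 2 s / 3` strictly increases along rays from the origin. -/
lemma potInvDeriv_add_lt {a b t : ℝ} (ha : 0 ≤ a) (hab : a < b) (ht : t ≠ 0) :
    potInvDeriv (a * t) + 2 / 3 * (a * t) < potInvDeriv (b * t) + 2 / 3 * (b * t) := by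
  rw [← tiltedDeriv_potInv, ← tiltedDeriv_potInv]
  have m := strictMono_potInv.monotone
  rcases lt_or_gt_of_ne ht with h | h
  · refine strictAntiOn_tiltedDeriv (Set.mem_Iic.2 ?_) (Set.mem_Iic.2 ?_)
      (strictMono_potInv (by nlinarith))
    · simpa using m (show b * t ≤ 0 by nlinarith)
    · simpa using m (show a * t ≤ 0 by nlinarith)
  · refine strictMonoOn_tiltedDeriv (Set.mem_Ici.2 ?_) (Set.mem_Ici.2 ?_)
      (strictMono_potInv (by nlinarith))
    · simpa using m (show 0 ≤ a * t by positivity)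
    · simpa using m (show 0 ≤ b * t by nlinarith)

/-- For `s < 0`, `potInvDeriv s * (1 - e^w) = 2|s|` with `e^w > 0` gives `potInvDeriv s > 2|s|`.
This linear growth makes the period unbounded. -/
lemma two_thirds_abs_le_potInvDeriv (s : ℝ) : 2 / 3 * |s| ≤ potInvDeriv s + 2 / 3 * s := by
  have h0 := potInvDeriv_pos s
  rcases le_or_gt 0 s with h | h
  · rw [abs_of_nonneg h]; linarith
  · rw [abs_of_neg h]
    have := potInvDeriv_mul_exp_sub_one s
    nlinarith [mul_pos h0 (Real.exp_pos (potInv s))]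

/-! ### Phase time and its inverse, the phase angle. -/

/-- The time at which the oscillation of amplitude `r` reaches the phase angle `θ`. -/
noncomputable def phaseTime (r θ : ℝ) : ℝ := ∫ φ in (0 : ℝ)..θ, potInvDeriv (r * -Real.cos φ)

/-- Half of the period of the oscillation of amplitude `r`. -/
noncomputable def halfPeriod (r : ℝ) : ℝ := phaseTime r π

lemma continuous_phaseIntegrand (r : ℝ) : Continuous fun φ => potInvDeriv (r * -Real.cos φ) :=
  continuous_potInvDeriv.comp (by fun_prop)

lemma continuous_phaseTime : Continuous fun p : ℝ × ℝ => phaseTime p.1 p.2 := by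
  unfold phaseTime
  refine intervalIntegral.continuous_parametric_intervalIntegral_of_continuous
    (f := fun (p : ℝ × ℝ) φ => potInvDeriv (p.1 * -Real.cos φ)) ?_ continuous_snd
  exact continuous_potInvDeriv.comp (by fun_prop)

lemma hasDerivAt_phaseTime (r θ : ℝ) :
    HasDerivAt (phaseTime r) (potInvDeriv (r * -Real.cos θ)) θ :=
  intervalIntegral.integral_hasDerivAt_right ((continuous_phaseIntegrand r).intervalIntegrable _ _)
    ((continuous_phaseIntegrand r).stronglyMeasurableAtFilter _ _)
    (continuous_phaseIntegrand r).continuousAt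

lemma strictMono_phaseTime (r : ℝ) : StrictMono (phaseTime r) :=
  strictMono_of_deriv_pos fun θ => by
    rw [(hasDerivAt_phaseTime r θ).deriv]; exact potInvDeriv_pos _

@[simp] lemma phaseTime_zero_right (r : ℝ) : phaseTime r 0 = 0 := by simp [phaseTime]

lemma phaseTime_neg_right (r θ : ℝ) : phaseTime r (-θ) = -phaseTime r θ := by
  have h := intervalIntegral.integral_comp_neg (a := 0) (b := θ)
    (fun φ => potInvDeriv (r * -Real.cos φ))
  simp only [Real.cos_neg, neg_zero] at h
  rw [phaseTime, phaseTime, h, ← intervalIntegral.integral_symm]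

/-- Substitute `φ ↦ π - φ`, which reverses the sign of `cos`. -/
lemma halfPeriod_neg (r : ℝ) : halfPeriod (-r) = halfPeriod r := by
  have h := intervalIntegral.integral_comp_sub_left (a := 0) (b := π)
    (fun φ => potInvDeriv (r * -Real.cos φ)) π
  simp only [Real.cos_pi_sub, sub_self, sub_zero] at h
  rw [halfPeriod, halfPeriod, phaseTime, phaseTime, ← h]
  simp

lemma phaseTime_add_pi (r θ : ℝ) : phaseTime r (θ + π) = halfPeriod r + phaseTime (-r) θ := by
  have h := intervalIntegral.integral_comp_add_right (a := 0) (b := θ)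
    (fun φ => potInvDeriv (r * -Real.cos φ)) π
  simp only [Real.cos_add_pi, zero_add] at h
  have h2 := intervalIntegral.integral_add_adjacent_intervals
    ((continuous_phaseIntegrand r).intervalIntegrable (μ := MeasureTheory.volume) 0 π)
    ((continuous_phaseIntegrand r).intervalIntegrable π (θ + π))
  rw [halfPeriod, phaseTime, phaseTime, phaseTime, ← h2, ← h]
  simp

lemma phaseTime_nat_mul_pi (n : ℕ) (r : ℝ) : phaseTime r (n * π) = n * halfPeriod r := by
  -- Each half turn reverses the sign of the amplitude, so the induction must vary `r`.
  induction n generalizing r with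
  | zero => simp
  | succ n ih =>
    push_cast
    rw [add_mul, one_mul, phaseTime_add_pi, ih, halfPeriod_neg]
    ring

lemma halfPeriod_pos (r : ℝ) : 0 < halfPeriod r := by
  have h := strictMono_phaseTime r Real.pi_pos
  rwa [phaseTime_zero_right] at h

lemma surjective_phaseTime (r : ℝ) : Function.Surjective (phaseTime r) := by
  intro y
  obtain ⟨n, hn⟩ := exists_nat_ge (|y| / halfPeriod r)
  rw [div_le_iff₀ (halfPeriod_pos r)] at hn
  have hc : Continuous (phaseTime r) :=
    continuous_iff_continuousAt.2 fun θ => (hasDerivAt_phaseTime r θ).continuousAt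
  refine mem_range_of_exists_le_of_exists_ge hc ⟨-(n * π), ?_⟩ ⟨n * π, ?_⟩
  · rw [phaseTime_neg_right, phaseTime_nat_mul_pi]
    linarith [neg_abs_le y]
  · rw [phaseTime_nat_mul_pi]
    linarith [le_abs_self y]

/-- The phase angle of the oscillation of amplitude `r` at a given time. -/
noncomputable def phaseAngle (r y : ℝ) : ℝ :=
  ((strictMono_phaseTime r).orderIsoOfSurjective _ (surjective_phaseTime r)).symm y

lemma phaseTime_phaseAngle (r y : ℝ) : phaseTime r (phaseAngle r y) = y :=
  ((strictMono_phaseTime r).orderIsoOfSurjective _ (surjective_phaseTime r)).apply_symm_apply y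

lemma phaseAngle_phaseTime (r θ : ℝ) : phaseAngle r (phaseTime r θ) = θ :=
  ((strictMono_phaseTime r).orderIsoOfSurjective _ (surjective_phaseTime r)).symm_apply_apply θ

lemma phaseAngle_eq_iff {r y θ : ℝ} : phaseAngle r y = θ ↔ y = phaseTime r θ :=
  ⟨fun h => by rw [← h, phaseTime_phaseAngle], fun h => by rw [h, phaseAngle_phaseTime]⟩

lemma surjective_phaseAngle (r : ℝ) : Function.Surjective (phaseAngle r) := fun θ =>
  ⟨phaseTime r θ, phaseAngle_phaseTime r θ⟩

lemma strictMono_phaseAngle (r : ℝ) : StrictMono (phaseAngle r) :=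
  ((strictMono_phaseTime r).orderIsoOfSurjective _ (surjective_phaseTime r)).symm.strictMono

/-- Joint continuity of an inverse by order alone: `a < phaseAngle r y` means `phaseTime r a < y`,
an open condition on `(r, y)`; likewise for `>`. -/
lemma continuous_phaseAngle : Continuous fun p : ℝ × ℝ => phaseAngle p.1 p.2 := by
  rw [continuous_iff_continuousAt]
  rintro ⟨r, y⟩
  have hlt : ∀ θ : ℝ, Continuous fun p : ℝ × ℝ => phaseTime p.1 θ := fun θ =>
    continuous_phaseTime.comp (continuous_fst.prodMk continuous_const)
  refine tendsto_order.2 ⟨fun a ha => ?_, fun a ha => ?_⟩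
  · have h := strictMono_phaseTime r ha
    rw [phaseTime_phaseAngle] at h
    filter_upwards [((hlt a).continuousAt (x := (r, y))).eventually_lt
      continuous_snd.continuousAt h] with p hp
    rwa [← (strictMono_phaseTime p.1).lt_iff_lt, phaseTime_phaseAngle]
  · have h := strictMono_phaseTime r ha
    rw [phaseTime_phaseAngle] at h
    filter_upwards [(continuous_snd.continuousAt (x := (r, y))).eventually_lt
      (hlt a).continuousAt h] with p hp
    rwa [← (strictMono_phaseTime p.1).lt_iff_lt, phaseTime_phaseAngle]

lemma hasDerivAt_phaseAngle (r y : ℝ) :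
    HasDerivAt (phaseAngle r) (potInvDeriv (r * -Real.cos (phaseAngle r y)))⁻¹ y :=
  (hasDerivAt_phaseTime r (phaseAngle r y)).of_local_left_inverse
    (continuous_phaseAngle.comp (continuous_const.prodMk continuous_id)).continuousAt
    (potInvDeriv_pos _).ne' (Filter.Eventually.of_forall (phaseTime_phaseAngle r))

@[simp] lemma phaseAngle_zero_right (r : ℝ) : phaseAngle r 0 = 0 := by
  simp [phaseAngle_eq_iff]

lemma phaseAngle_neg_right (r y : ℝ) : phaseAngle r (-y) = -phaseAngle r y := by
  rw [phaseAngle_eq_iff, phaseTime_neg_right, phaseTime_phaseAngle]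

lemma phaseAngle_add_halfPeriod (r y : ℝ) :
    phaseAngle r (y + halfPeriod r) = phaseAngle (-r) y + π := by
  rw [phaseAngle_eq_iff, phaseTime_add_pi, phaseTime_phaseAngle, add_comm]

/-! ### Monotonicity of the half period; the amplitude as its inverse. -/

lemma continuous_halfPeriod : Continuous halfPeriod :=
  continuous_phaseTime.comp (continuous_id.prodMk continuous_const)

lemma halfPeriod_zero : halfPeriod 0 = √2 * π := by
  simp [halfPeriod, phaseTime, potInvDeriv_zero, mul_comm]

/-- The added term is odd about `π/2` and integrates to zero. -/
lemma halfPeriod_eq_integral (r : ℝ) :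
    halfPeriod r = ∫ φ in (0 : ℝ)..π,
      (potInvDeriv (r * -Real.cos φ) + 2 / 3 * (r * -Real.cos φ)) := by
  rw [intervalIntegral.integral_add ((continuous_phaseIntegrand r).intervalIntegrable _ _)
    ((by fun_prop : Continuous fun φ => 2 / 3 * (r * -Real.cos φ)).intervalIntegrable _ _)]
  simp [halfPeriod, phaseTime]

lemma strictMonoOn_halfPeriod : StrictMonoOn halfPeriod (Set.Ici 0) := by
  intro a ha b _ hab
  have hc : ∀ r : ℝ, Continuous fun φ =>
      potInvDeriv (r * -Real.cos φ) + 2 / 3 * (r * -Real.cos φ) := fun r =>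
    (continuous_phaseIntegrand r).add (by fun_prop)
  rw [halfPeriod_eq_integral, halfPeriod_eq_integral]
  refine intervalIntegral.integral_lt_integral_of_continuousOn_of_le_of_exists_lt Real.pi_pos
    (hc a).continuousOn (hc b).continuousOn (fun φ _ => ?_)
    ⟨0, Set.left_mem_Icc.2 Real.pi_pos.le, potInvDeriv_add_lt ha hab (by simp)⟩
  rcases eq_or_ne (Real.cos φ) 0 with h | h
  · simp [h]
  · exact (potInvDeriv_add_lt ha hab (neg_ne_zero.2 h)).le

lemma mul_pi_div_three_le_halfPeriod {r : ℝ} (hr : 0 ≤ r) : r * π / 3 ≤ halfPeriod r := by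
  have h : ∫ φ in (0 : ℝ)..π, 2 / 3 * r * Real.cos φ ^ 2 = r * π / 3 := by
    rw [intervalIntegral.integral_const_mul, integral_cos_sq]
    simp; ring
  rw [← h, halfPeriod_eq_integral]
  refine intervalIntegral.integral_mono_on Real.pi_pos.le
    ((by fun_prop : Continuous fun φ => 2 / 3 * r * Real.cos φ ^ 2).intervalIntegrable _ _)
    (((continuous_phaseIntegrand r).add (by fun_prop)).intervalIntegrable _ _) fun φ _ => ?_
  refine le_trans ?_ (two_thirds_abs_le_potInvDeriv _)
  rw [abs_mul, abs_of_nonneg hr, abs_neg, ← sq_abs]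
  have h1 := Real.abs_cos_le_one φ
  have h2 : |Real.cos φ| ^ 2 ≤ |Real.cos φ| := by nlinarith [abs_nonneg (Real.cos φ)]
  nlinarith [mul_le_mul_of_nonneg_left h2 hr]

/-- `halfPeriod`, continued linearly to negative amplitudes so as to be an increasing bijection. -/
noncomputable def halfPeriodExt (r : ℝ) : ℝ := halfPeriod (max 0 r) + min 0 r

lemma strictMono_halfPeriodExt : StrictMono halfPeriodExt := by
  intro a b hab
  have hm := strictMonoOn_halfPeriod.monotoneOn (Set.mem_Ici.2 (le_max_left 0 a))
    (Set.mem_Ici.2 (le_max_left 0 b)) (max_le_max le_rfl hab.le)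
  unfold halfPeriodExt
  rcases lt_or_ge a 0 with h | h
  · have : min 0 a < min 0 b := by
      rw [min_eq_right h.le]; exact lt_min h hab
    linarith
  · rw [min_eq_left h, min_eq_left (h.trans hab.le), max_eq_right h, max_eq_right (h.trans hab.le)]
    linarith [strictMonoOn_halfPeriod (Set.mem_Ici.2 h) (Set.mem_Ici.2 (h.trans hab.le)) hab]

lemma halfPeriodExt_of_nonneg {r : ℝ} (hr : 0 ≤ r) : halfPeriodExt r = halfPeriod r := by
  simp [halfPeriodExt, hr]

lemma surjective_halfPeriodExt : Function.Surjective halfPeriodExt := by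
  intro T
  have hc : Continuous halfPeriodExt :=
    (continuous_halfPeriod.comp (by fun_prop)).add (by fun_prop)
  -- The value at the left point is `-|T|`; at the right point it is at least `|T| π / 3 ≥ |T|`.
  refine mem_range_of_exists_le_of_exists_ge hc ⟨-(halfPeriod 0 + |T|), ?_⟩ ⟨|T|, ?_⟩
  · have h : -(halfPeriod 0 + |T|) ≤ 0 := by
      have := halfPeriod_pos 0
      have := abs_nonneg T
      linarith
    rw [halfPeriodExt, max_eq_left h, min_eq_right h]
    linarith [neg_abs_le T]
  · rw [halfPeriodExt_of_nonneg (abs_nonneg T)]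
    have := mul_pi_div_three_le_halfPeriod (abs_nonneg T)
    nlinarith [le_abs_self T, abs_nonneg T, Real.pi_gt_three]

/-- The extended inverse of `halfPeriod`. -/
noncomputable def halfPeriodIso : ℝ ≃o ℝ :=
  strictMono_halfPeriodExt.orderIsoOfSurjective halfPeriodExt surjective_halfPeriodExt

/-- The nonnegative amplitude of the oscillation of half period `T`; it is `0` when `T` is at most
the limiting half period `√2 π` of small oscillations. -/
noncomputable def amplitude (T : ℝ) : ℝ := max 0 (halfPeriodIso.symm T)

lemma continuous_amplitude : Continuous amplitude :=
  continuous_const.max halfPeriodIso.symm.continuous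

lemma amplitude_nonneg (T : ℝ) : 0 ≤ amplitude T := le_max_left _ _

lemma amplitude_halfPeriod {r : ℝ} (hr : 0 ≤ r) : amplitude (halfPeriod r) = r := by
  have h : halfPeriodIso r = halfPeriod r := halfPeriodExt_of_nonneg hr
  rw [amplitude, ← h, OrderIso.symm_apply_apply, max_eq_right hr]

lemma amplitude_sqrt_two_mul_pi : amplitude (√2 * π) = 0 := by
  rw [← halfPeriod_zero, amplitude_halfPeriod le_rfl]

lemma exists_halfPeriod_eq {T : ℝ} (hT : √2 * π < T) : ∃ r, 0 < r ∧ halfPeriod r = T := by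
  have h0 : halfPeriodIso 0 = √2 * π := by
    rw [← halfPeriod_zero]; exact halfPeriodExt_of_nonneg le_rfl
  have h1 : 0 < halfPeriodIso.symm T := by
    rwa [← halfPeriodIso.lt_iff_lt, OrderIso.apply_symm_apply, h0]
  refine ⟨_, h1, ?_⟩
  rw [← halfPeriodExt_of_nonneg h1.le]
  exact halfPeriodIso.apply_symm_apply T

lemma amplitude_pos {T : ℝ} (hT : √2 * π < T) : 0 < amplitude T := by
  obtain ⟨r, hr, rfl⟩ := exists_halfPeriod_eq hT
  rwa [amplitude_halfPeriod hr.le]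

lemma halfPeriod_amplitude {T : ℝ} (hT : √2 * π < T) : halfPeriod (amplitude T) = T := by
  obtain ⟨r, hr, rfl⟩ := exists_halfPeriod_eq hT
  rw [amplitude_halfPeriod hr.le]

lemma amplitude_lt_amplitude {S T : ℝ} (hS : √2 * π < S) (hST : S < T) :
    amplitude S < amplitude T := by
  rw [← strictMonoOn_halfPeriod.lt_iff_lt (amplitude_nonneg S) (amplitude_nonneg T),
    halfPeriod_amplitude hS, halfPeriod_amplitude (hS.trans hST)]
  exact hST

lemma sqrt_two_mul_pi_lt_halfPeriod {r : ℝ} (hr : r ≠ 0) : √2 * π < halfPeriod r := by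
  rw [← halfPeriod_zero]
  rcases lt_or_gt_of_ne hr with h | h
  · rw [← halfPeriod_neg r]
    exact strictMonoOn_halfPeriod (Set.mem_Ici.2 le_rfl) (Set.mem_Ici.2 (by linarith)) (by linarith)
  · exact strictMonoOn_halfPeriod (Set.mem_Ici.2 le_rfl) (Set.mem_Ici.2 h.le) h

/-! ### The explicit odd solutions. -/

/-- The odd solution of `α (ψ'' - 2 ψ ψ') + 2 ψ = 0` of signed amplitude `r`. -/
noncomputable def wave (α r x : ℝ) : ℝ := √α⁻¹ * r * Real.sin (phaseAngle r (2 * √α⁻¹ * x))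

/-- The position `log (1 - α ψ')` of the oscillator which belongs to `ψ = wave α r`. -/
noncomputable def waveLog (α r x : ℝ) : ℝ :=
  potInv (r * -Real.cos (phaseAngle r (2 * √α⁻¹ * x)))

lemma hasDerivAt_phaseAngle_mul (α r x : ℝ) :
    HasDerivAt (fun x => phaseAngle r (2 * √α⁻¹ * x))
      ((potInvDeriv (r * -Real.cos (phaseAngle r (2 * √α⁻¹ * x))))⁻¹ * (2 * √α⁻¹)) x :=
  (hasDerivAt_phaseAngle r (2 * √α⁻¹ * x)).comp x
    (by simpa using (hasDerivAt_id x).const_mul (2 * √α⁻¹))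

lemma hasDerivAt_waveLog (α r x : ℝ) : HasDerivAt (waveLog α r) (2 * wave α r x) x := by
  have h1 := (((hasDerivAt_phaseAngle_mul α r x).cos).neg).const_mul r
  refine ((hasDerivAt_potInv _).comp x h1).congr_deriv ?_
  rw [wave]
  have := (potInvDeriv_pos (r * -Real.cos (phaseAngle r (2 * √α⁻¹ * x)))).ne'
  simp only [Pi.neg_apply]
  generalize phaseAngle r (2 * √α⁻¹ * x) = θ at *
  generalize √α⁻¹ = κ
  generalize potInvDeriv (r * -Real.cos θ) = d at *
  field_simp

lemma hasDerivAt_wave {α : ℝ} (hα : 0 < α) (r x : ℝ) :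
    HasDerivAt (wave α r) (α⁻¹ * (1 - Real.exp (waveLog α r x))) x := by
  refine (((hasDerivAt_phaseAngle_mul α r x).sin).const_mul (√α⁻¹ * r)).congr_deriv ?_
  have h0 := (potInvDeriv_pos (r * -Real.cos (phaseAngle r (2 * √α⁻¹ * x)))).ne'
  have h1 := potInvDeriv_mul_exp_sub_one (r * -Real.cos (phaseAngle r (2 * √α⁻¹ * x)))
  have h2 : √α⁻¹ * √α⁻¹ = α⁻¹ := Real.mul_self_sqrt (by positivity)
  rw [waveLog]
  generalize phaseAngle r (2 * √α⁻¹ * x) = θ at *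
  generalize √α⁻¹ = κ at *
  rw [← h2]
  generalize potInv (r * -Real.cos θ) = w at *
  generalize potInvDeriv (r * -Real.cos θ) = d at *
  field_simp
  linear_combination κ ^ 2 * h1

lemma deriv_wave {α : ℝ} (hα : 0 < α) (r : ℝ) :
    deriv (wave α r) = fun x => α⁻¹ * (1 - Real.exp (waveLog α r x)) :=
  funext fun x => (hasDerivAt_wave hα r x).deriv

lemma hasDerivAt_deriv_wave {α : ℝ} (hα : 0 < α) (r x : ℝ) :
    HasDerivAt (deriv (wave α r)) (2 * wave α r x * (deriv (wave α r) x - α⁻¹)) x := by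
  rw [deriv_wave hα]
  refine (((hasDerivAt_waveLog α r x).exp.const_sub 1).const_mul α⁻¹).congr_deriv ?_
  ring

lemma contDiff_wave {α : ℝ} (hα : 0 < α) (r : ℝ) : ContDiff ℝ 2 (wave α r) := by
  have hd : Differentiable ℝ (wave α r) := fun x => (hasDerivAt_wave hα r x).differentiableAt
  have hl : ContDiff ℝ 1 (waveLog α r) := by
    rw [contDiff_one_iff_deriv]
    refine ⟨fun x => (hasDerivAt_waveLog α r x).differentiableAt, ?_⟩
    rw [funext fun x => (hasDerivAt_waveLog α r x).deriv]
    exact continuous_const.mul hd.continuous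
  rw [show (2 : WithTop ℕ∞) = 1 + 1 from rfl, contDiff_succ_iff_deriv]
  refine ⟨hd, by simp, ?_⟩
  rw [deriv_wave hα]
  exact contDiff_const.mul (contDiff_const.sub hl.exp)

lemma wave_neg_right (α r x : ℝ) : wave α r (-x) = -wave α r x := by
  simp [wave, phaseAngle_neg_right]

@[simp] lemma wave_zero (α : ℝ) : wave α 0 = 0 := by ext x; simp [wave]

/-- Half a turn adds `π` to the angle and reverses `r`; the two sign changes in `r sin θ` cancel. -/
lemma wave_add_halfPeriod {α n r : ℝ} (hr : halfPeriod r = 2 * √α⁻¹ * (π / n))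
    (x : ℝ) : wave α r (x + π / n) = wave α (-r) x := by
  rw [wave, mul_add, ← hr, phaseAngle_add_halfPeriod, Real.sin_add_pi, wave]
  ring

lemma deriv_wave_zero {α : ℝ} (hα : 0 < α) (r : ℝ) :
    deriv (wave α r) 0 = α⁻¹ * (1 - Real.exp (potInv (-r))) := by
  simp [deriv_wave hα, waveLog]

lemma deriv_wave_zero_pos {α r : ℝ} (hα : 0 < α) (hr : 0 < r) : 0 < deriv (wave α r) 0 := by
  rw [deriv_wave_zero hα]
  have h := strictMono_potInv (show -r < 0 by linarith)
  rw [potInv_zero] at h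
  have := Real.exp_lt_one_iff.2 h
  exact mul_pos (by positivity) (by linarith)

lemma deriv_wave_zero_neg {α r : ℝ} (hα : 0 < α) (hr : r < 0) : deriv (wave α r) 0 < 0 := by
  rw [deriv_wave_zero hα]
  have h := strictMono_potInv (show 0 < -r by linarith)
  rw [potInv_zero] at h
  have := Real.one_lt_exp_iff.2 h
  exact mul_neg_of_pos_of_neg (by positivity) (by linarith)

lemma wave_ne_zero {α r : ℝ} (hα : 0 < α) (hr : r ≠ 0) : wave α r ≠ 0 := by
  intro h
  have h0 : deriv (wave α r) 0 = 0 := by rw [h]; simp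
  rcases lt_or_gt_of_ne hr with hr | hr
  · exact (deriv_wave_zero_neg hα hr).ne h0
  · exact (deriv_wave_zero_pos hα hr).ne' h0

lemma periodic_wave {α r n : ℝ}
    (hr : halfPeriod r = 2 * √α⁻¹ * (π / n)) : Function.Periodic (wave α r) (2 * π / n) := by
  intro x
  have e : x + 2 * π / n = (x + π / n) + π / n := by ring
  rw [e, wave_add_halfPeriod hr, wave_add_halfPeriod (by rw [halfPeriod_neg, hr]), neg_neg]

lemma periodic_wave_two_pi {α r : ℝ} {n : ℕ} (hn : 1 ≤ n)
    (hr : halfPeriod r = 2 * √α⁻¹ * (π / n)) : Function.Periodic (wave α r) (2 * π) := by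
  have h := (periodic_wave hr).nat_mul n
  have hn' : (n : ℝ) ≠ 0 := by positivity
  rwa [mul_div_cancel₀ _ hn'] at h

lemma Function.Periodic.deriv {f : ℝ → ℝ} {T : ℝ} (hf : Function.Periodic f T) :
    Function.Periodic (deriv f) T := fun x => by
  rw [← deriv_comp_add_const, show (fun x => f (x + T)) = f from funext hf]

lemma isStationarySolution_of_periodic {α r : ℝ} (hα : 0 < α)
    (hp : Function.Periodic (wave α r) (2 * π)) : IsStationarySolution α (wave α r) where
  contDiff := contDiff_wave hα r
  equation x := by
    rw [(hasDerivAt_deriv_wave hα r x).deriv]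
    field_simp
    ring
  odd := wave_neg_right α r
  periodic_value := by
    rw [← hp (-π)]; congr 1; ring
  periodic_deriv := by
    rw [← hp.deriv (-π)]; congr 1; ring

lemma isStationarySolution_zero (α : ℝ) : IsStationarySolution α 0 where
  contDiff := contDiff_const
  equation x := by simp
  odd x := by simp
  periodic_value := rfl
  periodic_deriv := by simp

/-! ### Every solution is a wave. -/

namespace IsStationarySolution

variable {α : ℝ} {ψ : ℝ → ℝ}

lemma hasDerivAt (h : IsStationarySolution α ψ) (x : ℝ) : HasDerivAt ψ (deriv ψ x) x :=
  ((h.contDiff.differentiable (by norm_num)) x).hasDerivAt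

lemma differentiable_deriv (h : IsStationarySolution α ψ) : Differentiable ℝ (deriv ψ) :=
  ((contDiff_succ_iff_deriv (n := 1)).1 h.contDiff).2.2.differentiable (by norm_num)

lemma hasDerivAt_deriv (h : IsStationarySolution α ψ) (hα : 0 < α) (x : ℝ) :
    HasDerivAt (deriv ψ) (2 * ψ x * (deriv ψ x - α⁻¹)) x := by
  refine (h.differentiable_deriv x).hasDerivAt.congr_deriv ?_
  have := h.equation x
  field_simp
  linarith

/-- `(ψ' - 1/α) exp (-∫ 2ψ)` is constant, so `ψ' ≥ 1/α` at `0` would persist everywhere, making `ψ`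
strictly increasing against `ψ(-π) = ψ(π)`. -/
lemma deriv_zero_lt (h : IsStationarySolution α ψ) (hα : 0 < α) : deriv ψ 0 < α⁻¹ := by
  by_contra! hc
  have hψ : Continuous ψ := h.contDiff.continuous
  set I : ℝ → ℝ := fun x => ∫ t in (0 : ℝ)..x, 2 * ψ t with hI
  have hI' : ∀ x, HasDerivAt I (2 * ψ x) x := fun x =>
    intervalIntegral.integral_hasDerivAt_right
      ((by fun_prop : Continuous fun t => 2 * ψ t).intervalIntegrable _ _)
      ((by fun_prop : Continuous fun t => 2 * ψ t).stronglyMeasurableAtFilter _ _)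
      (by fun_prop : Continuous fun t => 2 * ψ t).continuousAt
  have hz : ∀ x, HasDerivAt (fun x => (deriv ψ x - α⁻¹) * Real.exp (-I x)) 0 x := fun x => by
    refine (((h.hasDerivAt_deriv hα x).sub_const α⁻¹).mul (hI' x).neg.exp).congr_deriv ?_
    ring
  have hconst : ∀ x, (deriv ψ x - α⁻¹) * Real.exp (-I x) = deriv ψ 0 - α⁻¹ := fun x => by
    have := is_const_of_deriv_eq_zero (fun x => (hz x).differentiableAt)
      (fun x => (hz x).deriv) x 0
    simpa [hI] using this
  have hpos : ∀ x, 0 < deriv ψ x := fun x => by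
    have h1 := hconst x
    have h2 : 0 ≤ deriv ψ x - α⁻¹ := by
      by_contra! h3
      nlinarith [mul_neg_of_neg_of_pos h3 (Real.exp_pos (-I x))]
    have : 0 < α⁻¹ := by positivity
    linarith
  have hm := strictMono_of_deriv_pos hpos
  have := hm (show -π < π by linarith [Real.pi_pos])
  exact this.ne h.periodic_value

end IsStationarySolution

/-- Uniqueness for the initial value problem of `ψ'' = 2 ψ (ψ' - c)`. -/
lemma eq_of_hasDerivAt_deriv {c : ℝ} {f g : ℝ → ℝ}
    (hf : ∀ x, HasDerivAt f (deriv f x) x) (hg : ∀ x, HasDerivAt g (deriv g x) x)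
    (hf' : ∀ x, HasDerivAt (deriv f) (2 * f x * (deriv f x - c)) x)
    (hg' : ∀ x, HasDerivAt (deriv g) (2 * g x * (deriv g x - c)) x)
    (h0 : f 0 = g 0) (h1 : deriv f 0 = deriv g 0) : f = g := by
  set F : ℝ × ℝ → ℝ × ℝ := fun p => (p.2, 2 * p.1 * (p.2 - c)) with hF
  have hFc : ContDiff ℝ 1 F := by fun_prop
  ext x
  obtain ⟨M, hxM⟩ : ∃ M : ℝ, |x| < M := exists_gt _
  have hM : 0 < M := (abs_nonneg x).trans_lt hxM
  have cf : Continuous fun t => (f t, deriv f t) :=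
    continuous_iff_continuousAt.2 fun t => ((hf t).prodMk (hf' t)).continuousAt
  have cg : Continuous fun t => (g t, deriv g t) :=
    continuous_iff_continuousAt.2 fun t => ((hg t).prodMk (hg' t)).continuousAt
  -- The field is only locally Lipschitz; on `[-M, M]` both curves stay in one ball.
  obtain ⟨R, hR⟩ := ((isCompact_Icc (a := -M) (b := M)).image cf).isBounded.union
    ((isCompact_Icc (a := -M) (b := M)).image cg).isBounded |>.subset_closedBall 0
  obtain ⟨K, hK⟩ : ∃ K, LipschitzOnWith K F (Metric.closedBall 0 R) :=
    hFc.contDiffOn.exists_lipschitzOnWith (by norm_num) (convex_closedBall 0 R)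
      (isCompact_closedBall 0 R)
  have key := ODE_solution_unique_of_mem_Icc (v := fun _ => F) (s := fun _ => Metric.closedBall 0 R)
    (K := K) (f := fun t => (f t, deriv f t)) (g := fun t => (g t, deriv g t)) (t₀ := 0)
    (a := -M) (b := M) (fun _ _ => hK) ⟨by linarith, hM⟩ cf.continuousOn
    (fun t _ => (hf t).prodMk (hf' t))
    (fun t ht => hR (Or.inl ⟨t, Set.Ioo_subset_Icc_self ht, rfl⟩)) cg.continuousOn
    (fun t _ => (hg t).prodMk (hg' t))
    (fun t ht => hR (Or.inr ⟨t, Set.Ioo_subset_Icc_self ht, rfl⟩)) (by simp [h0, h1])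
  exact (Prod.ext_iff.1 (key (Set.mem_Icc.2 (abs_le.1 hxM.le)))).1

namespace IsStationarySolution

variable {α : ℝ} {ψ : ℝ → ℝ}

lemma apply_zero (h : IsStationarySolution α ψ) : ψ 0 = 0 := by
  have := h.odd 0
  rw [neg_zero] at this
  linarith

lemma apply_pi (h : IsStationarySolution α ψ) : ψ π = 0 := by
  have h1 := h.odd π
  have h2 := h.periodic_value
  linarith

lemma exists_eq_wave (h : IsStationarySolution α ψ) (hα : 0 < α) : ∃ r, ψ = wave α r := by
  have hp := h.deriv_zero_lt hα
  have hpos : 0 < 1 - α * deriv ψ 0 := by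
    have := mul_lt_mul_of_pos_left hp hα
    rw [mul_inv_cancel₀ hα.ne'] at this
    linarith
  -- `wave α r` starts at `w = potInv (-r)`, so this choice matches the initial slope.
  refine ⟨-potRoot (Real.log (1 - α * deriv ψ 0)), ?_⟩
  refine eq_of_hasDerivAt_deriv (c := α⁻¹) h.hasDerivAt
    (fun x => (hasDerivAt_wave hα _ x).differentiableAt.hasDerivAt)
    (h.hasDerivAt_deriv hα) (hasDerivAt_deriv_wave hα _) ?_ ?_
  · rw [h.apply_zero]; simp [wave]
  · rw [deriv_wave_zero hα, neg_neg, potInv_potRoot, Real.exp_log hpos]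
    field_simp
    ring

end IsStationarySolution

/-! ### Zeros and fundamental period. -/

lemma wave_eq_zero_iff {α r x : ℝ} (hα : 0 < α) (hr : r ≠ 0) (hx : 0 < x) :
    wave α r x = 0 ↔ ∃ n : ℕ, 1 ≤ n ∧ 2 * √α⁻¹ * x = n * halfPeriod r := by
  have hs : 0 < √α⁻¹ := Real.sqrt_pos.2 (by positivity)
  have h1 : wave α r x = 0 ↔ Real.sin (phaseAngle r (2 * √α⁻¹ * x)) = 0 := by
    rw [wave, mul_eq_zero, or_iff_right (mul_ne_zero hs.ne' hr)]
  rw [h1, Real.sin_eq_zero_iff]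
  constructor
  · rintro ⟨n, hn⟩
    have hpos : 0 < phaseAngle r (2 * √α⁻¹ * x) := by
      have := strictMono_phaseAngle r (show 0 < 2 * √α⁻¹ * x by positivity)
      rwa [phaseAngle_zero_right] at this
    rw [← hn] at hpos
    have hn0 : 0 < n := by
      have := pos_of_mul_pos_left hpos Real.pi_pos.le
      exact_mod_cast this
    lift n to ℕ using hn0.le
    refine ⟨n, by exact_mod_cast hn0, ?_⟩
    have := phaseAngle_eq_iff.1 hn.symm
    rw [this, ← phaseTime_nat_mul_pi]; rfl
  · rintro ⟨n, -, hn⟩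
    refine ⟨n, ?_⟩
    rw [hn, ← phaseTime_nat_mul_pi, phaseAngle_phaseTime]; rfl

lemma hasFundamentalPeriod_wave {α r n : ℝ} (hα : 0 < α) (hr0 : r ≠ 0) (hn : 0 < n)
    (hr : halfPeriod r = 2 * √α⁻¹ * (π / n)) :
    HasFundamentalPeriod (wave α r) (2 * π / n) := by
  have hs : 0 < √α⁻¹ := Real.sqrt_pos.2 (by positivity)
  refine ⟨⟨by positivity, periodic_wave hr⟩, ?_⟩
  rintro t ⟨ht, hper⟩
  have h0 : wave α r t = 0 := by
    have := hper 0
    rw [zero_add] at this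
    rw [this]; simp [wave]
  obtain ⟨m, hm1, hm⟩ := (wave_eq_zero_iff hα hr0 ht).1 h0
  -- A period is a zero of the odd function, hence a multiple `m` of the half period. If `m = 1`,
  -- the shift would identify the waves of amplitudes `r` and `-r`, whose slopes at `0` have
  -- opposite signs.
  have hm2 : 2 ≤ m := by
    by_contra! hlt
    obtain rfl : m = 1 := by omega
    have ht' : t = π / n := by
      rw [hr] at hm
      have : 2 * √α⁻¹ * (t - π / n) = 0 := by push_cast at hm; linarith
      rcases mul_eq_zero.1 this with h | h
      · exact absurd h (by positivity)
      · linarith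
    have hd : deriv (wave α r) 0 = deriv (wave α (-r)) 0 := by
      congr 1
      ext x
      rw [← wave_add_halfPeriod hr, ← ht', hper x]
    rcases lt_or_gt_of_ne hr0 with h | h
    · have h1 := deriv_wave_zero_neg hα h
      have h2 := deriv_wave_zero_pos hα (show 0 < -r by linarith)
      linarith
    · have h1 := deriv_wave_zero_pos hα h
      have h2 := deriv_wave_zero_neg hα (show -r < 0 by linarith)
      linarith
  have hm2' : (2 : ℝ) ≤ m := by exact_mod_cast hm2
  have h3 : 2 * √α⁻¹ * (2 * π / n) ≤ 2 * √α⁻¹ * t := by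
    rw [hm, hr]
    have : 0 ≤ 2 * √α⁻¹ * (π / n) := by positivity
    calc 2 * √α⁻¹ * (2 * π / n) = 2 * (2 * √α⁻¹ * (π / n)) := by ring
      _ ≤ _ := mul_le_mul_of_nonneg_right hm2' this
  exact le_of_mul_le_mul_left h3 (by positivity)

/-! ### Orbits in the phase plane as energy levels. -/

/-- The energy `V (log (1 - α p)) + α q²` of the point `(p, q)` of the phase plane. -/
noncomputable def phaseEnergy (α : ℝ) (z : EuclideanSpace ℝ (Fin 2)) : ℝ :=
  expPot (Real.log (1 - α * z 0)) + α * z 1 ^ 2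

/-- Coordinates of the half plane `p < 1 / α` in which the energy is `a² + b²`. -/
noncomputable def phaseChart (α : ℝ) (p : ℝ × ℝ) : EuclideanSpace ℝ (Fin 2) :=
  !₂[α⁻¹ * (1 - Real.exp (potInv p.1)), √α⁻¹ * p.2]

lemma continuous_phaseChart (α : ℝ) : Continuous (phaseChart α) := by
  have h := continuous_potInv
  unfold phaseChart
  refine (PiLp.continuous_toLp 2 _).comp (continuous_pi fun i => ?_)
  fin_cases i
  · exact continuous_const.mul (continuous_const.sub (h.comp continuous_fst).rexp)
  · exact continuous_const.mul continuous_snd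

lemma phaseChart_zero_lt {α : ℝ} (hα : 0 < α) (p : ℝ × ℝ) : phaseChart α p 0 < α⁻¹ := by
  have h : α⁻¹ * Real.exp (potInv p.1) > 0 := by positivity
  simp only [phaseChart, PiLp.toLp_apply, Matrix.cons_val_zero]
  linarith

lemma phaseEnergy_phaseChart {α : ℝ} (hα : 0 < α) (p : ℝ × ℝ) :
    phaseEnergy α (phaseChart α p) = p.1 ^ 2 + p.2 ^ 2 := by
  simp only [phaseEnergy, phaseChart, PiLp.toLp_apply, Matrix.cons_val_zero, Matrix.cons_val_one]
  rw [mul_inv_cancel_left₀ hα.ne', sub_sub_cancel, Real.log_exp, expPot_potInv, mul_pow,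
    Real.sq_sqrt (by positivity), mul_inv_cancel_left₀ hα.ne']

lemma exists_phaseChart_eq {α : ℝ} (hα : 0 < α) {z : EuclideanSpace ℝ (Fin 2)}
    (hz : z 0 < α⁻¹) : ∃ p, phaseChart α p = z := by
  have h1 : 0 < 1 - α * z 0 := by
    have := mul_lt_mul_of_pos_left hz hα
    rw [mul_inv_cancel₀ hα.ne'] at this
    linarith
  have hs : √α⁻¹ ≠ 0 := (Real.sqrt_pos.2 (by positivity)).ne'
  refine ⟨(potRoot (Real.log (1 - α * z 0)), z 1 / √α⁻¹), ?_⟩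
  ext i
  fin_cases i
  · simp only [phaseChart, potInv_potRoot, Real.exp_log h1]
    simp [inv_mul_cancel_left₀ hα.ne']
  · simp only [phaseChart]
    exact mul_div_cancel₀ _ hs

lemma phaseOrbit_wave_eq_range {α : ℝ} (hα : 0 < α) (r : ℝ) :
    phaseOrbit (wave α r) =
      Set.range fun θ => phaseChart α (r * -Real.cos θ, r * Real.sin θ) := by
  have hs : 0 < √α⁻¹ := Real.sqrt_pos.2 (by positivity)
  have e : ∀ x, (!₂[deriv (wave α r) x, wave α r x] : EuclideanSpace ℝ (Fin 2)) =
      phaseChart α (r * -Real.cos (phaseAngle r (2 * √α⁻¹ * x)),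
        r * Real.sin (phaseAngle r (2 * √α⁻¹ * x))) := fun x => by
    rw [deriv_wave hα, phaseChart, wave, mul_assoc]; rfl
  unfold phaseOrbit
  ext z
  constructor
  · rintro ⟨x, rfl⟩
    exact ⟨_, (e x).symm⟩
  · rintro ⟨θ, rfl⟩
    obtain ⟨y, rfl⟩ := surjective_phaseAngle r θ
    refine ⟨y / (2 * √α⁻¹), ?_⟩
    simp only [e]
    rw [mul_div_cancel₀ _ (by positivity)]

lemma phaseOrbit_wave_eq_image {α : ℝ} (hα : 0 < α) (r : ℝ) :
    phaseOrbit (wave α r) = phaseChart α '' {p | p.1 ^ 2 + p.2 ^ 2 = r ^ 2} := by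
  rw [phaseOrbit_wave_eq_range hα]
  ext z
  constructor
  · rintro ⟨θ, rfl⟩
    refine ⟨_, ?_, rfl⟩
    simp only [Set.mem_ofPred_eq]
    linear_combination r ^ 2 * Real.sin_sq_add_cos_sq θ
  · rintro ⟨⟨a, b⟩, hab, rfl⟩
    simp only [Set.mem_ofPred_eq] at hab
    rcases eq_or_ne r 0 with rfl | hr
    · have ha : a = 0 := by nlinarith [sq_nonneg a, sq_nonneg b]
      have hb : b = 0 := by nlinarith [sq_nonneg a, sq_nonneg b]
      exact ⟨0, by simp [ha, hb]⟩
    -- The argument of this unit complex number is the required angle: `cos θ = -a/r`, `sin θ =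
    -- b/r`.
    · set ζ : ℂ := ⟨-a / r, b / r⟩ with hζ
      have hn : ‖ζ‖ = 1 := by
        rw [Complex.norm_eq_sqrt_sq_add_sq, Real.sqrt_eq_one]
        simp only [hζ]
        field_simp
        linarith
      have h0 : ζ ≠ 0 := by
        intro h; rw [h] at hn; simp at hn
      refine ⟨ζ.arg, ?_⟩
      simp only [Complex.cos_arg h0, Complex.sin_arg, hn]
      congr 2 <;> simp [hζ] <;> field_simp

/-- The level set depends on `r²` only, so `±r` share an orbit. The condition `z 0 < α⁻¹` discards
points where `Real.log` is taken outside its natural domain. -/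
lemma phaseOrbit_wave {α : ℝ} (hα : 0 < α) (r : ℝ) :
    phaseOrbit (wave α r) = {z | z 0 < α⁻¹ ∧ phaseEnergy α z = r ^ 2} := by
  rw [phaseOrbit_wave_eq_image hα]
  ext z
  constructor
  · rintro ⟨p, hp, rfl⟩
    exact ⟨phaseChart_zero_lt hα p, by rw [phaseEnergy_phaseChart hα]; exact hp⟩
  · rintro ⟨hz, hE⟩
    obtain ⟨p, rfl⟩ := exists_phaseChart_eq hα hz
    exact ⟨p, by rwa [phaseEnergy_phaseChart hα] at hE, rfl⟩

lemma phaseOrbit_wave_neg {α : ℝ} (hα : 0 < α) (r : ℝ) :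
    phaseOrbit (wave α (-r)) = phaseOrbit (wave α r) := by
  rw [phaseOrbit_wave hα, phaseOrbit_wave hα, neg_sq]

lemma isCompact_phaseEnergy_le {α : ℝ} (hα : 0 < α) (r : ℝ) :
    IsCompact {z : EuclideanSpace ℝ (Fin 2) | z 0 < α⁻¹ ∧ phaseEnergy α z ≤ r ^ 2} := by
  have hK : IsCompact {p : ℝ × ℝ | p.1 ^ 2 + p.2 ^ 2 ≤ r ^ 2} := by
    refine (isCompact_closedBall (0 : ℝ × ℝ) |r|).of_isClosed_subset
      (isClosed_le (by fun_prop) continuous_const) fun p hp => ?_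
    simp only [Set.mem_ofPred_eq] at hp
    rw [mem_closedBall_zero_iff, Prod.norm_def, max_le_iff, Real.norm_eq_abs, Real.norm_eq_abs]
    exact ⟨sq_le_sq.1 (by nlinarith [sq_nonneg p.2]), sq_le_sq.1 (by nlinarith [sq_nonneg p.1])⟩
  convert hK.image (continuous_phaseChart α) using 1
  ext z
  constructor
  · rintro ⟨hz, hE⟩
    obtain ⟨p, rfl⟩ := exists_phaseChart_eq hα hz
    exact ⟨p, by rwa [phaseEnergy_phaseChart hα] at hE, rfl⟩
  · rintro ⟨p, hp, rfl⟩
    exact ⟨phaseChart_zero_lt hα p, by rw [phaseEnergy_phaseChart hα]; exact hp⟩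

lemma isOpen_phaseEnergy_lt {α : ℝ} (hα : 0 < α) (r : ℝ) :
    IsOpen {z : EuclideanSpace ℝ (Fin 2) | z 0 < α⁻¹ ∧ phaseEnergy α z < r ^ 2} := by
  have h0 : IsOpen {z : EuclideanSpace ℝ (Fin 2) | z 0 < α⁻¹} :=
    isOpen_lt (by fun_prop) continuous_const
  have hc : ContinuousOn (phaseEnergy α) {z : EuclideanSpace ℝ (Fin 2) | z 0 < α⁻¹} := by
    refine ContinuousOn.add ?_ (by fun_prop)
    refine continuous_expPot.comp_continuousOn (ContinuousOn.log (by fun_prop) fun z hz => ?_)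
    have hz : z 0 < α⁻¹ := hz
    have := mul_lt_mul_of_pos_left hz hα
    rw [mul_inv_cancel₀ hα.ne'] at this
    linarith
  exact hc.isOpen_inter_preimage h0 isOpen_Iio

/-- Off the orbit, the plane splits into the open sublevel set and the complement of the compact
one. The connected component of the origin meets the former, so it stays there and is bounded. -/
lemma enclosesOrigin_wave {α r : ℝ} (hα : 0 < α) (hr : r ≠ 0) :
    EnclosesOrigin (phaseOrbit (wave α r)) := by
  have hE0 : phaseEnergy α 0 = 0 := by simp [phaseEnergy, expPot]
  have hr2 : 0 < r ^ 2 := by positivity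
  have h0 : (0 : EuclideanSpace ℝ (Fin 2)) ∉ phaseOrbit (wave α r) := by
    rw [phaseOrbit_wave hα]
    rintro ⟨-, h⟩
    rw [hE0] at h
    exact hr2.ne h
  refine ⟨h0, ?_⟩
  have hK := isCompact_phaseEnergy_le hα r
  have hsub : {z : EuclideanSpace ℝ (Fin 2) | z 0 < α⁻¹ ∧ phaseEnergy α z < r ^ 2} ⊆
      {z | z 0 < α⁻¹ ∧ phaseEnergy α z ≤ r ^ 2} := fun z hz => ⟨hz.1, hz.2.le⟩
  refine hK.isBounded.subset (Set.Subset.trans ?_ hsub)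
  refine isPreconnected_connectedComponentIn.subset_left_of_subset_union
    (isOpen_phaseEnergy_lt hα r) hK.isClosed.isOpen_compl ?_ ?_ ?_
  · exact Set.disjoint_compl_right_iff_subset.2 hsub
  · refine (connectedComponentIn_subset _ _).trans fun z hz => ?_
    rw [phaseOrbit_wave hα] at hz
    by_cases hzK : z 0 < α⁻¹ ∧ phaseEnergy α z ≤ r ^ 2
    · exact Or.inl ⟨hzK.1, lt_of_le_of_ne hzK.2 fun h => hz ⟨hzK.1, h⟩⟩
    · exact Or.inr hzK
  · exact ⟨0, mem_connectedComponentIn h0, by simpa using hα, by rw [hE0]; exact hr2⟩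

/-! ### Distance of an orbit from the origin. -/

/-- The squared distance from the origin along a level set of the energy has its minimum where
the level set meets one of the two axes. -/
lemma nonneg_or_le_of_expPot {c w₀ w : ℝ} (hc : 1 / 2 < c) (hw : w₀ ≤ w) :
    0 ≤ c ^ 2 * (1 - Real.exp w) ^ 2 - c * expPot w ∨
      c ^ 2 * (1 - Real.exp w₀) ^ 2 - c * expPot w₀ ≤
        c ^ 2 * (1 - Real.exp w) ^ 2 - c * expPot w := by
  set f : ℝ → ℝ := fun w => c ^ 2 * (1 - Real.exp w) ^ 2 - c * expPot w with hf
  have hf' : ∀ w, HasDerivAt f (c * (Real.exp w - 1) * (2 * c * Real.exp w - 1)) w := fun w => by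
    refine (((((Real.hasDerivAt_exp w).const_sub 1).pow 2).const_mul (c ^ 2)).sub
      ((hasDerivAt_expPot w).const_mul c)).congr_deriv ?_
    push_cast; ring
  have hfc : Continuous f := continuous_iff_continuousAt.2 fun w => (hf' w).continuousAt
  have hf0 : f 0 = 0 := by simp [hf, expPot]
  have hc0 : 0 < 2 * c := by linarith
  -- The critical points of `f` are `0` and `m`, and `c > 1/2` puts `m` below `0`: `f` increases up
  -- to `m`, decreases to `f 0 = 0`, then increases.
  set m := Real.log (2 * c)⁻¹ with hm
  have hexpm : Real.exp m = (2 * c)⁻¹ := Real.exp_log (by positivity)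
  have hm0 : m < 0 := Real.log_neg (by positivity) (inv_lt_one_of_one_lt₀ (by linarith))
  change 0 ≤ f w ∨ f w₀ ≤ f w
  have key : ∀ x, 2 * c * Real.exp x - 1 = 2 * c * (Real.exp x - Real.exp m) := fun x => by
    rw [hexpm]; field_simp
  rcases le_or_gt 0 w with h | h
  · left
    have : MonotoneOn f (Set.Ici 0) := monotoneOn_of_deriv_nonneg (convex_Ici 0) hfc.continuousOn
      (fun x _ => (hf' x).differentiableAt.differentiableWithinAt) fun x hx => by
        rw [interior_Ici] at hx
        rw [(hf' x).deriv, key]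
        have h1 := Real.one_lt_exp_iff.2 hx
        have h2 := Real.exp_lt_exp.2 (hm0.trans hx)
        exact mul_nonneg (mul_nonneg (by linarith) (by linarith))
          (mul_nonneg (by linarith) (by linarith))
    rw [← hf0]
    exact this (Set.mem_Ici.2 le_rfl) (Set.mem_Ici.2 h) h
  rcases le_or_gt m w with h' | h'
  · left
    have : AntitoneOn f (Set.Icc m 0) := antitoneOn_of_deriv_nonpos (convex_Icc m 0)
      hfc.continuousOn
      (fun x _ => (hf' x).differentiableAt.differentiableWithinAt) fun x hx => by
        rw [interior_Icc] at hx
        rw [(hf' x).deriv, key]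
        have h1 := Real.exp_lt_one_iff.2 hx.2
        have h2 := Real.exp_lt_exp.2 hx.1
        exact mul_nonpos_of_nonpos_of_nonneg
          (mul_nonpos_of_nonneg_of_nonpos (by linarith) (by linarith))
          (mul_nonneg (by linarith) (by linarith))
    rw [← hf0]
    exact this ⟨h', h.le⟩ ⟨hm0.le, le_rfl⟩ h.le
  · right
    have : MonotoneOn f (Set.Iic m) := monotoneOn_of_deriv_nonneg (convex_Iic m) hfc.continuousOn
      (fun x _ => (hf' x).differentiableAt.differentiableWithinAt) fun x hx => by
        rw [interior_Iic] at hx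
        have hx : x < m := hx
        rw [(hf' x).deriv, key]
        have h1 := Real.exp_lt_one_iff.2 (hx.trans hm0)
        have h2 := Real.exp_lt_exp.2 hx
        exact mul_nonneg_of_nonpos_of_nonpos
          (mul_nonpos_of_nonneg_of_nonpos (by linarith) (by linarith))
          (mul_nonpos_of_nonneg_of_nonpos (by linarith) (by linarith))
    exact this (Set.mem_Iic.2 (hw.trans h'.le)) (Set.mem_Iic.2 h'.le) hw

lemma norm_phaseChart_sq {α : ℝ} (hα : 0 < α) (p : ℝ × ℝ) :
    ‖phaseChart α p‖ ^ 2 = α⁻¹ ^ 2 * (1 - Real.exp (potInv p.1)) ^ 2 + α⁻¹ * p.2 ^ 2 := by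
  have h : √α⁻¹ ^ 2 = α⁻¹ := Real.sq_sqrt (by positivity)
  rw [EuclideanSpace.norm_sq_eq, Fin.sum_univ_two]
  simp only [phaseChart, PiLp.toLp_apply, Matrix.cons_val_zero, Matrix.cons_val_one,
    Real.norm_eq_abs, sq_abs]
  rw [mul_pow, mul_pow, h]

lemma infDist_phaseOrbit_wave {α r : ℝ} (hα : 0 < α) (hα2 : α < 2) (hr : 0 < r) :
    Metric.infDist 0 (phaseOrbit (wave α r)) =
      min (√α⁻¹ * r) (α⁻¹ * (1 - Real.exp (potInv (-r)))) := by
  have hs : 0 < √α⁻¹ := Real.sqrt_pos.2 (by positivity)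
  have hs2 : √α⁻¹ ^ 2 = α⁻¹ := Real.sq_sqrt (by positivity)
  have hd : 0 < α⁻¹ * (1 - Real.exp (potInv (-r))) := by
    rw [← deriv_wave_zero hα]; exact deriv_wave_zero_pos hα hr
  rw [phaseOrbit_wave_eq_image hα]
  apply le_antisymm
  · refine le_min ?_ ?_
    · refine (Metric.infDist_le_dist_of_mem (Set.mem_image_of_mem _
        (show ((0 : ℝ), r) ∈ {p : ℝ × ℝ | p.1 ^ 2 + p.2 ^ 2 = r ^ 2} by simp))).trans ?_
      rw [dist_zero_left]
      refine (pow_le_pow_iff_left₀ (norm_nonneg _) (by positivity) two_ne_zero).1 ?_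
      rw [norm_phaseChart_sq hα, mul_pow, hs2]
      simp
    · refine (Metric.infDist_le_dist_of_mem (Set.mem_image_of_mem _
        (show (-r, (0 : ℝ)) ∈ {p : ℝ × ℝ | p.1 ^ 2 + p.2 ^ 2 = r ^ 2} by simp))).trans ?_
      rw [dist_zero_left]
      refine (pow_le_pow_iff_left₀ (norm_nonneg _) hd.le two_ne_zero).1 ?_
      rw [norm_phaseChart_sq hα, mul_pow]
      simp
  · refine (Metric.le_infDist (Set.Nonempty.image _ ⟨(0, r), by simp⟩)).2 ?_
    rintro _ ⟨⟨a, b⟩, hab, rfl⟩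
    simp only [Set.mem_ofPred_eq] at hab
    have ha : -r ≤ a := (abs_le.1 (abs_le_of_sq_le_sq (by nlinarith [sq_nonneg b]) hr.le)).1
    have hc : 1 / 2 < α⁻¹ := by
      rw [one_div]; exact (inv_lt_inv₀ two_pos hα).2 hα2
    rw [dist_zero_left]
    rcases nonneg_or_le_of_expPot hc (strictMono_potInv.monotone ha) with h | h
    · refine (min_le_left _ _).trans ?_
      refine (pow_le_pow_iff_left₀ (by positivity) (norm_nonneg _) two_ne_zero).1 ?_
      rw [norm_phaseChart_sq hα, mul_pow, hs2]
      rw [expPot_potInv] at h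
      simp only
      nlinarith
    · refine (min_le_right _ _).trans ?_
      refine (pow_le_pow_iff_left₀ hd.le (norm_nonneg _) two_ne_zero).1 ?_
      rw [norm_phaseChart_sq hα, mul_pow]
      rw [expPot_potInv, expPot_potInv, neg_sq] at h
      simp only
      nlinarith

/-! ### Uniform dependence on the parameters. -/

/-- Joint continuity gives convergence in the compact-open topology, hence uniformly on `[0, T]`;
the common period carries this to the whole line. -/
lemma tendstoUniformly_of_periodic {F : ℝ × ℝ → ℝ → ℝ}
    (hF : Continuous fun q : (ℝ × ℝ) × ℝ => F q.1 q.2)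
    {l : Filter ℝ} {p : ℝ → ℝ × ℝ} {p₀ : ℝ × ℝ} (hp : Filter.Tendsto p l (𝓝 p₀)) {T : ℝ}
    (hT : 0 < T) (hper : ∀ᶠ α in l, Function.Periodic (F (p α)) T)
    (hper₀ : Function.Periodic (F p₀) T) : TendstoUniformly (fun α => F (p α)) (F p₀) l := by
  let Φ : C(ℝ × ℝ, C(ℝ, ℝ)) := ContinuousMap.curry ⟨fun q => F q.1 q.2, hF⟩
  have h1 : Filter.Tendsto (fun α => Φ (p α)) l (𝓝 (Φ p₀)) := (Φ.continuous.tendsto p₀).comp hp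
  have h2 := ContinuousMap.tendsto_iff_forall_isCompact_tendstoUniformlyOn.1 h1 _
    (isCompact_Icc (a := (0 : ℝ)) (b := T))
  rw [Metric.tendstoUniformly_iff]
  intro ε hε
  filter_upwards [Metric.tendstoUniformlyOn_iff.1 h2 ε hε, hper] with α hα hpα x
  have hpair : Function.Periodic (fun x => (F p₀ x, F (p α) x)) T := fun x => by
    simp only [hper₀ x, hpα x]
  obtain ⟨y, hy, hxy⟩ := hpair.exists_mem_Ico₀ hT x
  have e1 := congrArg Prod.fst hxy
  have e2 := congrArg Prod.snd hxy
  simp only at e1 e2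
  rw [e1, e2]
  exact hα y (Set.Ico_subset_Icc_self hy)

/-- The solution `wave α r` as a function of the parameters `(√α⁻¹, r)`. -/
noncomputable def waveParam (p : ℝ × ℝ) (x : ℝ) : ℝ :=
  p.1 * p.2 * Real.sin (phaseAngle p.2 (2 * p.1 * x))

/-- The derivative of `wave α r` as a function of the parameters `(√α⁻¹, r)`. -/
noncomputable def waveDerivParam (p : ℝ × ℝ) (x : ℝ) : ℝ :=
  p.1 ^ 2 * (1 - Real.exp (potInv (p.2 * -Real.cos (phaseAngle p.2 (2 * p.1 * x)))))

lemma continuous_phaseAngle_param :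
    Continuous fun q : (ℝ × ℝ) × ℝ => phaseAngle q.1.2 (2 * q.1.1 * q.2) :=
  continuous_phaseAngle.comp₂ (continuous_snd.comp continuous_fst) (by fun_prop)

lemma continuous_waveParam : Continuous fun q : (ℝ × ℝ) × ℝ => waveParam q.1 q.2 :=
  (by fun_prop : Continuous fun q : (ℝ × ℝ) × ℝ => q.1.1 * q.1.2).mul
    (Real.continuous_sin.comp continuous_phaseAngle_param)

lemma continuous_waveDerivParam : Continuous fun q : (ℝ × ℝ) × ℝ => waveDerivParam q.1 q.2 := by
  have h : Continuous fun q : (ℝ × ℝ) × ℝ =>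
      q.1.2 * -Real.cos (phaseAngle q.1.2 (2 * q.1.1 * q.2)) :=
    (continuous_snd.comp continuous_fst).mul
      (Real.continuous_cos.comp continuous_phaseAngle_param).neg
  exact ((continuous_fst.comp continuous_fst).pow 2).mul
    (continuous_const.sub (Real.continuous_exp.comp (continuous_potInv.comp h)))

lemma deriv_wave_eq_waveDerivParam {α : ℝ} (hα : 0 < α) (r : ℝ) :
    deriv (wave α r) = waveDerivParam (√α⁻¹, r) := by
  have h2 : √α⁻¹ ^ 2 = α⁻¹ := Real.sq_sqrt (by positivity)
  rw [deriv_wave hα]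
  ext x
  simp only [waveDerivParam, waveLog, h2]

lemma tendstoC1_wave {l : Filter ℝ} {α₀ r₀ : ℝ} {ρ : ℝ → ℝ} (hα₀ : 0 < α₀) (hl : l ≤ 𝓝 α₀)
    (hρ : Filter.Tendsto ρ l (𝓝 r₀))
    (hper : ∀ᶠ α in l, Function.Periodic (wave α (ρ α)) (2 * π))
    (hper₀ : Function.Periodic (wave α₀ r₀) (2 * π)) :
    TendstoC1 (fun α => wave α (ρ α)) (wave α₀ r₀) l := by
  have hκ : Filter.Tendsto (fun α : ℝ => √α⁻¹) l (𝓝 √α₀⁻¹) :=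
    ((continuousAt_inv₀ hα₀.ne').sqrt.tendsto).mono_left hl
  have hp : Filter.Tendsto (fun α => (√α⁻¹, ρ α)) l (𝓝 (√α₀⁻¹, r₀)) := hκ.prodMk_nhds hρ
  have hpos : ∀ᶠ α in l, 0 < α := hl (lt_mem_nhds hα₀)
  constructor
  · exact tendstoUniformly_of_periodic continuous_waveParam hp Real.two_pi_pos hper hper₀
  · have h := tendstoUniformly_of_periodic continuous_waveDerivParam hp Real.two_pi_pos
      (by
        filter_upwards [hper, hpos] with α h1 h2
        rw [← deriv_wave_eq_waveDerivParam h2]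
        exact h1.deriv)
      (by rw [← deriv_wave_eq_waveDerivParam hα₀]; exact hper₀.deriv)
    rw [deriv_wave_eq_waveDerivParam hα₀]
    intro u hu
    filter_upwards [h u hu, hpos] with α h1 h2
    rwa [deriv_wave_eq_waveDerivParam h2]

/-! ### The branches and their monotonicity in `α`. -/

/-- The half period, in the time scale of the oscillator, of solutions of fundamental period
`2 π / j`. -/
noncomputable def branchHalfPeriod (j : ℕ) (α : ℝ) : ℝ := 2 * √α⁻¹ * (π / j)

/-- The amplitude of the solutions of fundamental period `2 π / j`. -/
noncomputable def branchAmplitude (j : ℕ) (α : ℝ) : ℝ := amplitude (branchHalfPeriod j α)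

section Branch

variable {j : ℕ} {α : ℝ}

lemma sqrt_two_mul_pi_lt_branchHalfPeriod_iff (hj : 1 ≤ j) (hα : 0 < α) :
    √2 * π < branchHalfPeriod j α ↔ α < 2 / (j : ℝ) ^ 2 := by
  have hj0 : (0 : ℝ) < j := by exact_mod_cast hj
  have e : branchHalfPeriod j α = 2 * √α⁻¹ / j * π := by unfold branchHalfPeriod; ring
  rw [e, mul_lt_mul_iff_left₀ Real.pi_pos,
    ← pow_lt_pow_iff_left₀ (Real.sqrt_nonneg 2) (by positivity) two_ne_zero,
    Real.sq_sqrt two_pos.le, div_pow, mul_pow, Real.sq_sqrt (by positivity),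
    lt_div_iff₀ (by positivity), lt_div_iff₀ (by positivity)]
  constructor
  · intro h
    have := mul_lt_mul_of_pos_right h hα
    field_simp at this
    linarith
  · intro h
    have : 2 * (α * (j : ℝ) ^ 2) * α⁻¹ < 2 * 2 * α⁻¹ := by gcongr
    field_simp at this ⊢
    linarith

lemma branchHalfPeriod_two_div_sq (hj : 1 ≤ j) : branchHalfPeriod j (2 / (j : ℝ) ^ 2) = √2 * π := by
  have hj0 : (0 : ℝ) < j := by exact_mod_cast hj
  have h2 : √(2 : ℝ) * √2 = 2 := Real.mul_self_sqrt two_pos.le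
  have h3 : √(2 : ℝ) ≠ 0 := by positivity
  rw [branchHalfPeriod, inv_div, Real.sqrt_div (by positivity), Real.sqrt_sq hj0.le]
  field_simp
  linarith

lemma branchHalfPeriod_lt {β : ℝ} (hj : 1 ≤ j) (hα : 0 < α) (h : α < β) :
    branchHalfPeriod j β < branchHalfPeriod j α := by
  have hj0 : (0 : ℝ) < j := by exact_mod_cast hj
  have h1 : √β⁻¹ < √α⁻¹ :=
    Real.sqrt_lt_sqrt (inv_nonneg.2 (hα.trans h).le) ((inv_lt_inv₀ (hα.trans h) hα).2 h)
  unfold branchHalfPeriod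
  gcongr

lemma branchAmplitude_pos (hj : 1 ≤ j) (hα : α ∈ Set.Ioo 0 (2 / (j : ℝ) ^ 2)) :
    0 < branchAmplitude j α :=
  amplitude_pos ((sqrt_two_mul_pi_lt_branchHalfPeriod_iff hj hα.1).2 hα.2)

lemma halfPeriod_branchAmplitude (hj : 1 ≤ j) (hα : α ∈ Set.Ioo 0 (2 / (j : ℝ) ^ 2)) :
    halfPeriod (branchAmplitude j α) = 2 * √α⁻¹ * (π / j) :=
  halfPeriod_amplitude ((sqrt_two_mul_pi_lt_branchHalfPeriod_iff hj hα.1).2 hα.2)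

lemma strictAntiOn_branchAmplitude (hj : 1 ≤ j) :
    StrictAntiOn (branchAmplitude j) (Set.Ioo 0 (2 / (j : ℝ) ^ 2)) := fun _ hα _ hβ h =>
  amplitude_lt_amplitude ((sqrt_two_mul_pi_lt_branchHalfPeriod_iff hj hβ.1).2 hβ.2)
    (branchHalfPeriod_lt hj hα.1 h)

lemma continuousAt_branchAmplitude (j : ℕ) (hα : 0 < α) : ContinuousAt (branchAmplitude j) α :=
  continuous_amplitude.continuousAt.comp
    ((continuousAt_const.mul (continuousAt_inv₀ hα.ne').sqrt).mul continuousAt_const)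

/-- Both signs of the amplitude give a branch of solutions which bifurcates from zero. -/
lemma bifurcatesFromZero_wave (hj : 1 ≤ j) {σ : ℝ} (hσ : σ = 1 ∨ σ = -1) :
    BifurcatesFromZero (2 / (j : ℝ) ^ 2) fun α => wave α (σ * branchAmplitude j α) := by
  have hj0 : (0 : ℝ) < j := by exact_mod_cast hj
  have hs0 : σ ≠ 0 := by rcases hσ with rfl | rfl <;> norm_num
  have hper : ∀ α ∈ Set.Ioo 0 (2 / (j : ℝ) ^ 2),
      Function.Periodic (wave α (σ * branchAmplitude j α)) (2 * π) := fun α hα => by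
    refine periodic_wave_two_pi hj ?_
    rw [← halfPeriod_branchAmplitude hj hα]
    rcases hσ with rfl | rfl
    · rw [one_mul]
    · rw [neg_one_mul, halfPeriod_neg]
  refine ⟨fun α hα => isStationarySolution_of_periodic hα.1 (hper α hα),
    fun α hα => wave_ne_zero hα.1 (mul_ne_zero hs0 (branchAmplitude_pos hj hα).ne'),
    fun α hα => tendstoC1_wave hα.1 le_rfl
      (((continuousAt_branchAmplitude j hα.1).tendsto).const_mul σ) ?_ (hper α hα), ?_⟩
  · filter_upwards [Ioo_mem_nhds hα.1 hα.2] with β hβ using hper β hβ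
  · have ha : 0 < 2 / (j : ℝ) ^ 2 := by positivity
    have h0 : σ * branchAmplitude j (2 / (j : ℝ) ^ 2) = 0 := by
      rw [branchAmplitude, branchHalfPeriod_two_div_sq hj, amplitude_sqrt_two_mul_pi, mul_zero]
    have h1 := ((continuousAt_branchAmplitude j ha).tendsto).const_mul σ
    rw [h0] at h1
    -- The trivial solution is the wave of amplitude `0` at the endpoint, so the limit is another
    -- case of continuity in the parameters.
    rw [← wave_zero (2 / (j : ℝ) ^ 2)]
    refine tendstoC1_wave ha nhdsWithin_le_nhds (h1.mono_left nhdsWithin_le_nhds) ?_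
      (by rw [wave_zero]; intro x; rfl)
    filter_upwards [Ioo_mem_nhdsLT ha] with β hβ using hper β hβ

lemma inv_mul_one_sub_exp_lt {β r s : ℝ} (hα : 0 < α) (h : α < β) (hs : 0 < s) (hrs : s < r) :
    β⁻¹ * (1 - Real.exp (potInv (-s))) < α⁻¹ * (1 - Real.exp (potInv (-r))) := by
  have hβ := hα.trans h
  have h1 : β⁻¹ < α⁻¹ := (inv_lt_inv₀ hβ hα).2 h
  have h2 := Real.exp_lt_exp.2 (strictMono_potInv (show -r < -s by linarith))
  have h3 : potInv (-s) < 0 := by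
    simpa using strictMono_potInv (show -s < 0 by linarith)
  have h4 := Real.exp_lt_one_iff.2 h3
  exact mul_lt_mul'' h1 (by linarith) (by positivity) (by linarith)

lemma strictAntiOn_deriv_wave (hj : 1 ≤ j) :
    StrictAntiOn (fun α => deriv (wave α (branchAmplitude j α)) 0)
      (Set.Ioo 0 (2 / (j : ℝ) ^ 2)) := by
  intro α hα β hβ h
  simp only [deriv_wave_zero hα.1, deriv_wave_zero hβ.1]
  exact inv_mul_one_sub_exp_lt hα.1 h (branchAmplitude_pos hj hβ)
    (strictAntiOn_branchAmplitude hj hα hβ h)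

lemma two_div_sq_le_two (hj : 1 ≤ j) : 2 / (j : ℝ) ^ 2 ≤ 2 := by
  have hj0 : (1 : ℝ) ≤ j := by exact_mod_cast hj
  exact div_le_self two_pos.le (one_le_pow₀ hj0)

lemma strictAntiOn_infDist_phaseOrbit (hj : 1 ≤ j) :
    StrictAntiOn (fun α => Metric.infDist 0 (phaseOrbit (wave α (branchAmplitude j α))))
      (Set.Ioo 0 (2 / (j : ℝ) ^ 2)) := by
  intro α hα β hβ h
  have h2 := two_div_sq_le_two hj
  have hr := branchAmplitude_pos hj hβ
  have hrs := strictAntiOn_branchAmplitude hj hα hβ h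
  simp only
  rw [infDist_phaseOrbit_wave hα.1 (hα.2.trans_le h2) (branchAmplitude_pos hj hα),
    infDist_phaseOrbit_wave hβ.1 (hβ.2.trans_le h2) hr]
  refine min_lt_min ?_ (inv_mul_one_sub_exp_lt hα.1 h hr hrs)
  have h1 : √β⁻¹ < √α⁻¹ :=
    Real.sqrt_lt_sqrt (inv_nonneg.2 hβ.1.le) ((inv_lt_inv₀ hβ.1 hα.1).2 h)
  exact mul_lt_mul'' h1 hrs (Real.sqrt_nonneg _) hr.le

end Branch

/-! ### Classification and count of the solutions. -/

/-- Every nontrivial solution lies on one of the branches. -/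
lemma IsStationarySolution.exists_branch {α : ℝ} {ψ : ℝ → ℝ} (h : IsStationarySolution α ψ)
    (hα : 0 < α) (h0 : ψ ≠ 0) : ∃ j : ℕ, 1 ≤ j ∧ α < 2 / (j : ℝ) ^ 2 ∧
      (ψ = wave α (branchAmplitude j α) ∨ ψ = wave α (-branchAmplitude j α)) := by
  obtain ⟨r, rfl⟩ := h.exists_eq_wave hα
  have hr : r ≠ 0 := by
    rintro rfl
    exact h0 (wave_zero α)
  obtain ⟨n, hn, he⟩ := (wave_eq_zero_iff hα hr Real.pi_pos).1 h.apply_pi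
  have hn0 : (0 : ℝ) < n := by exact_mod_cast hn
  have hT : halfPeriod r = branchHalfPeriod n α := by
    unfold branchHalfPeriod
    field_simp at he ⊢
    linarith
  refine ⟨n, hn, ?_, ?_⟩
  -- A nonzero amplitude has half period above the limit `√2 π` of small oscillations; this is the
  -- bound on `α`.
  · rw [← sqrt_two_mul_pi_lt_branchHalfPeriod_iff hn hα, ← hT]
    exact sqrt_two_mul_pi_lt_halfPeriod hr
  · rcases lt_or_gt_of_ne hr with h | h
    · right
      rw [branchAmplitude, ← hT, ← halfPeriod_neg, amplitude_halfPeriod (by linarith), neg_neg]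
    · left
      rw [branchAmplitude, ← hT, amplitude_halfPeriod h.le]

theorem theorem3p1 :
    -- for `α ≥ 2` the trivial solution is the unique solution
    (∀ α : ℝ, 2 ≤ α → ∀ ψ : ℝ → ℝ, IsStationarySolution α ψ ↔ ψ = 0) ∧
    -- the solutions `ψp j α = ψ_j^+` and `ψm j α = ψ_j^-`
    ∃ ψp ψm : ℕ → ℝ → ℝ → ℝ,
      -- for `2/(k+1)² ≤ α < 2/k²` there are exactly `2k` nontrivial solutions, the `ψ_j^±`
      (∀ k : ℕ, 1 ≤ k → ∀ α : ℝ, 2 / ((k : ℝ) + 1) ^ 2 ≤ α → α < 2 / (k : ℝ) ^ 2 →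
        {ψ : ℝ → ℝ | IsStationarySolution α ψ ∧ ψ ≠ 0} =
          {ψ : ℝ → ℝ | ∃ j : ℕ, 1 ≤ j ∧ j ≤ k ∧ (ψ = ψp j α ∨ ψ = ψm j α)} ∧
        {ψ : ℝ → ℝ | IsStationarySolution α ψ ∧ ψ ≠ 0}.ncard = 2 * k ∧
        ∀ j : ℕ, 1 ≤ j → j ≤ k →
          HasFundamentalPeriod (ψp j α) (2 * π / j) ∧
          HasFundamentalPeriod (ψm j α) (2 * π / j) ∧
          (∀ x : ℝ, ψm j α x = ψp j α (x + π / j)) ∧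
          0 < deriv (ψp j α) 0 ∧ deriv (ψm j α) 0 < 0 ∧
          EnclosesOrigin (phaseOrbit (ψp j α)) ∧
          EnclosesOrigin (phaseOrbit (ψm j α))) ∧
      (∀ j : ℕ, 1 ≤ j →
        -- each pair bifurcates from the trivial solution at `α_j = 2/j²`, i.e. `β_j = 8π/j²`
        couplingOfBeta (8 * π / (j : ℝ) ^ 2) = 2 / (j : ℝ) ^ 2 ∧
        BifurcatesFromZero (2 / (j : ℝ) ^ 2) (ψp j) ∧
        BifurcatesFromZero (2 / (j : ℝ) ^ 2) (ψm j) ∧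
        -- the distance of the orbits from the origin increases as `α` decreases
        StrictAntiOn (fun α : ℝ => Metric.infDist 0 (phaseOrbit (ψp j α)))
          (Set.Ioo 0 (2 / (j : ℝ) ^ 2)) ∧
        StrictAntiOn (fun α : ℝ => Metric.infDist 0 (phaseOrbit (ψm j α)))
          (Set.Ioo 0 (2 / (j : ℝ) ^ 2)) ∧
        StrictAntiOn (fun α : ℝ => deriv (ψp j α) 0) (Set.Ioo 0 (2 / (j : ℝ) ^ 2))) := by
  refine ⟨fun α hα ψ => ⟨fun h => ?_, fun h => h ▸ isStationarySolution_zero α⟩,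
    fun j α => wave α (branchAmplitude j α), fun j α => wave α (-branchAmplitude j α), ?_, ?_⟩
  · by_contra h0
    obtain ⟨j, hj, hlt, -⟩ := h.exists_branch (by linarith) h0
    linarith [two_div_sq_le_two hj]
  · intro k hk α hα1 hα2
    have hk0 : (0 : ℝ) < k := by exact_mod_cast hk
    have hα : 0 < α := lt_of_lt_of_le (by positivity) hα1
    have hmem : ∀ j : ℕ, 1 ≤ j → j ≤ k → α ∈ Set.Ioo 0 (2 / (j : ℝ) ^ 2) := fun j hj hjk => by
      have hj0 : (0 : ℝ) < j := by exact_mod_cast hj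
      have hjk' : (j : ℝ) ≤ k := by exact_mod_cast hjk
      exact ⟨hα, hα2.trans_le (by gcongr)⟩
    have hprop : ∀ j : ℕ, 1 ≤ j → j ≤ k →
        HasFundamentalPeriod (wave α (branchAmplitude j α)) (2 * π / j) ∧
        HasFundamentalPeriod (wave α (-branchAmplitude j α)) (2 * π / j) ∧
        (∀ x : ℝ, wave α (-branchAmplitude j α) x = wave α (branchAmplitude j α) (x + π / j)) ∧
        0 < deriv (wave α (branchAmplitude j α)) 0 ∧
        deriv (wave α (-branchAmplitude j α)) 0 < 0 ∧
        EnclosesOrigin (phaseOrbit (wave α (branchAmplitude j α))) ∧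
        EnclosesOrigin (phaseOrbit (wave α (-branchAmplitude j α))) := fun j hj hjk => by
      have hj0 : (0 : ℝ) < j := by exact_mod_cast hj
      have hr := branchAmplitude_pos hj (hmem j hj hjk)
      have hP := halfPeriod_branchAmplitude hj (hmem j hj hjk)
      exact ⟨hasFundamentalPeriod_wave hα hr.ne' hj0 hP,
        hasFundamentalPeriod_wave hα (neg_ne_zero.2 hr.ne') hj0 (by rw [halfPeriod_neg, hP]),
        fun x => (wave_add_halfPeriod hP x).symm,
        deriv_wave_zero_pos hα hr, deriv_wave_zero_neg hα (by linarith),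
        enclosesOrigin_wave hα hr.ne', enclosesOrigin_wave hα (neg_ne_zero.2 hr.ne')⟩
    have hset : {ψ : ℝ → ℝ | IsStationarySolution α ψ ∧ ψ ≠ 0} =
        {ψ : ℝ → ℝ | ∃ j : ℕ, 1 ≤ j ∧ j ≤ k ∧
          (ψ = wave α (branchAmplitude j α) ∨ ψ = wave α (-branchAmplitude j α))} := by
      ext ψ
      constructor
      · rintro ⟨h, h0⟩
        obtain ⟨j, hj, hlt, hψ⟩ := h.exists_branch hα h0
        refine ⟨j, hj, ?_, hψ⟩
        by_contra! hjk
        have hjk' : (k : ℝ) + 1 ≤ j := by exact_mod_cast hjk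
        have : 2 / (j : ℝ) ^ 2 ≤ 2 / ((k : ℝ) + 1) ^ 2 := by gcongr
        linarith
      · rintro ⟨j, hj, hjk, rfl | rfl⟩
        · have := bifurcatesFromZero_wave hj (Or.inl rfl)
          simp only [one_mul] at this
          exact ⟨this.solution α (hmem j hj hjk), this.nontrivial α (hmem j hj hjk)⟩
        · have := bifurcatesFromZero_wave hj (Or.inr rfl)
          simp only [neg_one_mul] at this
          exact ⟨this.solution α (hmem j hj hjk), this.nontrivial α (hmem j hj hjk)⟩
    refine ⟨hset, ?_, hprop⟩
    have hunion : {ψ : ℝ → ℝ | IsStationarySolution α ψ ∧ ψ ≠ 0} =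
        (fun j : ℕ => wave α (branchAmplitude j α)) '' Set.Icc 1 k ∪
          (fun j : ℕ => wave α (-branchAmplitude j α)) '' Set.Icc 1 k := by
      rw [hset]
      ext ψ
      constructor
      · rintro ⟨j, hj, hjk, h | h⟩
        · exact Or.inl ⟨j, ⟨hj, hjk⟩, h.symm⟩
        · exact Or.inr ⟨j, ⟨hj, hjk⟩, h.symm⟩
      · rintro (⟨j, ⟨hj, hjk⟩, h⟩ | ⟨j, ⟨hj, hjk⟩, h⟩)
        · exact ⟨j, hj, hjk, Or.inl h.symm⟩
        · exact ⟨j, hj, hjk, Or.inr h.symm⟩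
    -- For the count: within one sign the fundamental period recovers `j`, and the two signs are
    -- separated by the slope at `0`.
    have hperiod : ∀ i ∈ Set.Icc 1 k, ∀ j ∈ Set.Icc 1 k,
        (2 * π / i : ℝ) = 2 * π / j → i = j := fun i hi j hj h => by
      have hi0 : (0 : ℝ) < i := by exact_mod_cast hi.1
      have hj0 : (0 : ℝ) < j := by exact_mod_cast hj.1
      rw [div_eq_div_iff hi0.ne' hj0.ne'] at h
      exact_mod_cast (mul_left_cancel₀ Real.two_pi_pos.ne' h).symm
    have hinjp : Set.InjOn (fun j : ℕ => wave α (branchAmplitude j α)) (Set.Icc 1 k) :=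
      fun i hi j hj h => hperiod i hi j hj
        ((hprop i hi.1 hi.2).1.unique (by
          simp only at h
          rw [h]
          exact (hprop j hj.1 hj.2).1))
    have hinjm : Set.InjOn (fun j : ℕ => wave α (-branchAmplitude j α)) (Set.Icc 1 k) :=
      fun i hi j hj h => hperiod i hi j hj
        ((hprop i hi.1 hi.2).2.1.unique (by
          simp only at h
          rw [h]
          exact (hprop j hj.1 hj.2).2.1))
    have hcard : (Set.Icc 1 k).ncard = k := by
      rw [Set.ncard_eq_toFinset_card']; simp
    have hdisj : Disjoint ((fun j : ℕ => wave α (branchAmplitude j α)) '' Set.Icc 1 k)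
        ((fun j : ℕ => wave α (-branchAmplitude j α)) '' Set.Icc 1 k) := by
      rw [Set.disjoint_left]
      rintro _ ⟨i, hi, rfl⟩ ⟨j, hj, h⟩
      have h1 := (hprop i hi.1 hi.2).2.2.2.1
      have h2 := (hprop j hj.1 hj.2).2.2.2.2.1
      simp only at h
      rw [h] at h2
      linarith
    rw [hunion, Set.ncard_union_eq hdisj ((Set.finite_Icc 1 k).image _)
      ((Set.finite_Icc 1 k).image _), hinjp.ncard_image, hinjm.ncard_image, hcard]
    ring
  · intro j hj
    have hj0 : (0 : ℝ) < j := by exact_mod_cast hj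
    have hp := bifurcatesFromZero_wave hj (Or.inl rfl)
    have hm := bifurcatesFromZero_wave hj (Or.inr rfl)
    simp only [one_mul] at hp
    simp only [neg_one_mul] at hm
    refine ⟨?_, hp, hm, strictAntiOn_infDist_phaseOrbit hj, ?_, strictAntiOn_deriv_wave hj⟩
    · have := Real.pi_ne_zero
      unfold couplingOfBeta
      field_simp
      norm_num
    · refine (strictAntiOn_infDist_phaseOrbit hj).congr fun α hα => ?_
      simp only
      rw [phaseOrbit_wave_neg hα.1]
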